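/- **Setting.** Let $m\ge 2$, $\pi_0\in[0,1]$, $\pi_1=1-\pi_0$, $\rho\in[0,1]$, $\mu>0$, let $\overline\Phi(z)=\mathbb P(Z\ge z)$ for $Z\sim\mathcal N(0,1)$, extended by $\overline\Phi(-\infty)=1$, $\overline\Phi(+\infty)=0$, with inverse $\overline\Phi^{-1}:[0,1]\to[-\infty,+\infty]$. The unconditional equicorrelated multivariate normal model $\overline P=\overline P^N_{(\pi_0,\rho,\mu)}$ is the law of $(H,\mathbf p)$, where $H_1,\dots,H_m\in\{0,1\}$ are i.i.d. with $\mathbb P(H_i=0)=\pi_0$ and, conditionally on $H$, $\mathbf p=(p_i)_{1\le i\le m}$ is distributed as $(\overline\Phi(X_i+\mu H_i))_{1\le i\le m}$ with $X$ a centered Gaussian vector whose covariance matrix has $1$ on the diagonal and $\rho$ elsewhere. Put $\mathcal H_0=\{i: H_i=0\}$, $\mathcal H_1=\{i:H_i=1\}$. A threshold is a nondecreasing sequence $\mathbf t=(t_k)_{1\le k\le m}$ in $[0,1]$, with $t_0=0$. Let $p_{(1)}\le\dots\le p_{(m)}$ be the ordered $p$-values and $p_{(0)}=0$. The step-up procedure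 is $\mathrm{SU}(\mathbf t)=\{i:p_i\le t_{\hat k}\}$ with $\hat k=\max\{0\le k\le m: p_{(k)}\le t_k\}$; the step-down procedure is $\mathrm{SD}(\mathbf t)=\{i:p_i\le t_{\tilde k}\}$ with $\tilde k=\max\{0\le k\le m:\forall k'\le k,\ p_{(k')}\le t_{k'}\}$. For a procedure $R$, let $\mathrm{FDP}(R)=|\mathcal H_0\cap R|/(|R|\vee1)$, $\mathrm{FDR}(R)=\mathbb E_{\overline P}[\mathrm{FDP}(R)]$ and, if $\pi_1>0$, $\mathrm{Pow}(R)=(\pi_1m)^{-1}\,\mathbb E_{\overline P}|\mathcal H_1\cap R|$. Let $\Psi_k(s_1,\dots,s_k)=\mathbb P(U_{(1)}\le s_1,\dots,U_{(k)}\le s_k)$ for the order statistics of $k$ i.i.d. uniform variables on $(0,1)$ ($\Psi_0=1$), and for $0\le k\le n$ let $$\mathcal D_n(\mathbf s,k)=\tbinom nk s_k^{\,k}\,\Psi_{n-k}(1-s_n,\dots,1-s_{k+1}),\qquad \widetilde{\mathcal D}_n(\mathbf s,k)=\tbinom nk(1-s_{k+1})^{n-k}\,\Psi_k(s_1,\dots,s_k),$$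 where a factor with exponent $0$ is $1$. Let $\left\{{s\atop \ell}\right\}$ be the Stirling numbers of the second kind. For $u\in(0,1)$, $t\in[0,1]$ let, if $\rho<1$, $$F_0(t|u)=\overline\Phi\Big(\tfrac{\overline\Phi^{-1}(t)-\sqrt\rho\,\overline\Phi^{-1}(u)}{\sqrt{1-\rho}}\Big),\qquad F_1(t|u)=\overline\Phi\Big(\tfrac{\overline\Phi^{-1}(t)-\sqrt\rho\,\overline\Phi^{-1}(u)-\mu}{\sqrt{1-\rho}}\Big),$$ and, if $\rho=1$, $F_0(t|u)=\mathbf 1\{u\le t\}$, $F_1(t|u)=\mathbf 1\{u\le\overline\Phi(\overline\Phi^{-1}(t)-\mu)\}$. Let $G(t|u)=\pi_0F_0(t|u)+\pi_1F_1(t|u)$. Quotients $0/0$ below are read as $0$. **Statement.** For every threshold $\mathbf t$ all the integrands below are integrable on $(0,1)$ and the following hold. 1. For all $x\in(0,1)$, $$\mathbb P[\mathrm{FDP}(\mathrm{SU}(\mathbf t))\le x]=\int_0^1\sum_{k=0}^m\sum_{j=0}^{\lfloor xk\rfloor}\binom kj\Big(\frac{\pi_0F_0(t_k|u)}{G(t_k|u)}\Big)^j\Big(\frac{\pi_1F_1(t_k|u)}{G(t_k|u)}\Big)^{k-j}\mathcal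 D_m\big([G(t_i|u)]_{1\le i\le m},k\big)\,du.$$ 2. For all integers $s\ge1$, $$\mathbb E[\mathrm{FDP}(\mathrm{SU}(\mathbf t))^s]=\int_0^1\sum_{\ell=1}^{s\wedge m}\frac{m!}{(m-\ell)!}\left\{{s\atop \ell}\right\}\pi_0^\ell\sum_{k=\ell}^m\frac{F_0(t_k|u)^\ell}{k^s}\,\mathcal D_{m-\ell}\big([G(t_{j+\ell}|u)]_{1\le j\le m-\ell},k-\ell\big)\,du.$$ 3. $$\mathrm{FDR}(\mathrm{SU}(\mathbf t))=\int_0^1\pi_0m\sum_{k=1}^m\frac{F_0(t_k|u)}k\,\mathcal D_{m-1}\big([G(t_{j+1}|u)]_{1\le j\le m-1},k-1\big)\,du.$$ 4. If $\pi_0<1$, $$\mathrm{Pow}(\mathrm{SU}(\mathbf t))=\int_0^1\sum_{k=1}^mF_1(t_k|u)\,\mathcal D_{m-1}\big([G(t_{j+1}|u)]_{1\le j\le m-1},k-1\big)\,du.$$ 5. $$\mathrm{FDR}(\mathrm{SD}(\mathbf t))=\int_0^1\pi_0m\sum_{k=1}^m\sum_{k'=k}^m\frac{F_0(t_k|u)}{k'}\,\widetilde{\mathcal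 D}_{m-1}\big([G(t_j|u)]_{1\le j\le m-1},k-1\big)\,\widetilde{\mathcal D}_{m-k}\Big(\Big[\tfrac{G(t_{k+j}|u)-G(t_k|u)}{1-G(t_k|u)}\Big]_{1\le j\le m-k},k'-k\Big)\,du.$$ 6. If $\pi_0<1$, $$\mathrm{Pow}(\mathrm{SD}(\mathbf t))=\int_0^1\sum_{k=1}^mF_1(t_k|u)\,\widetilde{\mathcal D}_{m-1}\big([G(t_j|u)]_{1\le j\le m-1},k-1\big)\,du.$$ -/

import Mathlib

namespace StepwiseFDP

noncomputable section

open MeasureTheory ProbabilityTheory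

/-! ### Order statistics, thresholds, step-up and step-down procedures -/

/-- The order statistics `p_(1) ≤ ... ≤ p_(m)` of a finite real family, indexed from `1`,
with the convention `p_(0) = 0` (indices above `m` are never used). -/
def orderStat {m : ℕ} (p : Fin m → ℝ) (k : ℕ) : ℝ :=
  if h : 1 ≤ k ∧ k ≤ m then p (Tuple.sort p ⟨k - 1, by omega⟩) else 0

/-- `(t_k)_{1 ≤ k ≤ m}` is a threshold: a nondecreasing sequence in `[0,1]`, with the
convention `t_0 = 0`. Values `t k` with `k > m` are irrelevant. -/
structure IsThreshold (m : ℕ) (t : ℕ → ℝ) : Prop where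
  zero : t 0 = 0
  mem_Icc : ∀ k ∈ Set.Icc 1 m, t k ∈ Set.Icc (0 : ℝ) 1
  mono : MonotoneOn t (Set.Icc 1 m)

open Classical in
/-- `max {k ∈ {0,...,m} | p_(k) ≤ t_k}` (the index `k = 0` always belongs to this set). -/
def stepUpIndex {m : ℕ} (t : ℕ → ℝ) (p : Fin m → ℝ) : ℕ :=
  Nat.findGreatest (fun k => orderStat p k ≤ t k) m

open Classical in
/-- `max {k ∈ {0,...,m} | ∀ k' ≤ k, p_(k') ≤ t_k'}` (`k = 0` always belongs to this set). -/
def stepDownIndex {m : ℕ} (t : ℕ → ℝ) (p : Fin m → ℝ) : ℕ :=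
  Nat.findGreatest (fun k => ∀ k' ≤ k, orderStat p k' ≤ t k') m

open Classical in
/-- The step-up procedure of threshold `t`: the set of rejected hypotheses. -/
def SU {m : ℕ} (t : ℕ → ℝ) (p : Fin m → ℝ) : Finset (Fin m) :=
  {i | p i ≤ t (stepUpIndex t p)}

open Classical in
/-- The step-down procedure of threshold `t`: the set of rejected hypotheses. -/
def SD {m : ℕ} (t : ℕ → ℝ) (p : Fin m → ℝ) : Finset (Fin m) :=
  {i | p i ≤ t (stepDownIndex t p)}

/-! ### FDP, FDR and power

A configuration is `H : Fin m → Bool`; `H i = false` stands for `H_i = 0` (true null),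
`H i = true` for `H_i = 1` (false null). -/

/-- The set of true nulls. -/
def trueNulls {m : ℕ} (H : Fin m → Bool) : Finset (Fin m) := {i | H i = false}

/-- The set of false nulls. -/
def falseNulls {m : ℕ} (H : Fin m → Bool) : Finset (Fin m) := {i | H i = true}

/-- The false discovery proportion of a rejection set. -/
def FDP {m : ℕ} (R : Finset (Fin m)) (H : Fin m → Bool) : ℝ :=
  ((trueNulls H ∩ R).card : ℝ) / (max R.card 1 : ℕ)

/-- The false discovery rate of the procedure `R` when `(H, p) ∼ P`. -/
def FDR {m : ℕ} (R : (Fin m → ℝ) → Finset (Fin m))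
    (P : Measure ((Fin m → Bool) × (Fin m → ℝ))) : ℝ :=
  ∫ z, FDP (R z.2) z.1 ∂P

/-- The power of the procedure `R` when `(H, p) ∼ P`, where `π₁` is the prior probability that
a hypothesis is false: `(π₁ m)⁻¹ E |H₁ ∩ R|`. It is meaningful for `π₁ > 0` only. -/
def power {m : ℕ} (R : (Fin m → ℝ) → Finset (Fin m)) (π₁ : ℝ)
    (P : Measure ((Fin m → Bool) × (Fin m → ℝ))) : ℝ :=
  (π₁ * m)⁻¹ * ∫ z, ((falseNulls z.1 ∩ R z.2).card : ℝ) ∂P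

/-! ### The equicorrelated multivariate normal model -/

/-- The standard Gaussian upper tail `P(Z ≥ z)`, on the extended reals
(so that the value is `1` at `-∞` and `0` at `+∞`). -/
def gaussTail (z : EReal) : ℝ := (gaussianReal 0 1).real {x : ℝ | z ≤ (x : EReal)}

/-- The inverse `[0,1] → [-∞,+∞]` of the decreasing bijection `gaussTail`. -/
def gaussTailInv (t : ℝ) : EReal := sSup {z : EReal | t ≤ gaussTail z}

/-- The covariance matrix with `1` on the diagonal and `ρ` elsewhere. -/
def equicorrMatrix (m : ℕ) (ρ : ℝ) : Matrix (Fin m) (Fin m) ℝ :=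
  Matrix.of fun i j => if i = j then 1 else ρ

/-- The conditional EMN model given `H`: the law of `(gaussTail (X_i + μ H_i))_i`, where `X` is a
centered Gaussian vector with covariance matrix `equicorrMatrix m ρ`. -/
def condEMN {m : ℕ} (ρ μ : ℝ) (H : Fin m → Bool) : Measure (Fin m → ℝ) :=
  (multivariateGaussian 0 (equicorrMatrix m ρ)).map
    fun X i => gaussTail ((X i + μ * (if H i then 1 else 0) : ℝ) : EReal)

/-- The prior on configurations: the `H_i` are i.i.d. with `P(H_i = 0) = π₀`,
`P(H_i = 1) = 1 - π₀`. -/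
def prior (m : ℕ) (π₀ : ℝ) : Measure (Fin m → Bool) :=
  Measure.pi fun _ => ENNReal.ofReal π₀ • Measure.dirac false
    + ENNReal.ofReal (1 - π₀) • Measure.dirac true

/-- The unconditional EMN model: the law of `(H, p)` where `H ∼ prior m π₀` and, given `H`,
the family `p` follows the conditional EMN model. -/
def uncondEMN (m : ℕ) (π₀ ρ μ : ℝ) : Measure ((Fin m → Bool) × (Fin m → ℝ)) :=
  (prior m π₀).compProd (Kernel.ofFunOfCountable (condEMN ρ μ))

/-- The conditional c.d.f. of a `p`-value under the null, given that the common factor is `u`. -/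
def condF0 (ρ u t : ℝ) : ℝ :=
  if ρ = 1 then (if u ≤ t then 1 else 0)
  else gaussTail
    ((gaussTailInv t - (√ρ : ℝ) * gaussTailInv u) / ((√(1 - ρ) : ℝ) : EReal))

/-- The conditional c.d.f. of a `p`-value under the alternative, given the common factor `u`. -/
def condF1 (ρ μ u t : ℝ) : ℝ :=
  if ρ = 1 then (if u ≤ gaussTail (gaussTailInv t - (μ : EReal)) then 1 else 0)
  else gaussTail
    ((gaussTailInv t - (√ρ : ℝ) * gaussTailInv u - (μ : EReal)) / ((√(1 - ρ) : ℝ) : EReal))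

/-! ### The formulas of the independent model -/

/-- `Ψ_k(t_1,...,t_k) = P(U_(1) ≤ t_1, ..., U_(k) ≤ t_k)` for `U_1,...,U_k` i.i.d. uniform on
`(0,1)`; in particular `Ψ_0 = 1`. -/
def Psi (k : ℕ) (t : ℕ → ℝ) : ℝ :=
  (Measure.pi fun _ : Fin k => (volume : Measure ℝ).restrict (Set.Ioo 0 1)).real
    {U | ∀ j ∈ Set.Icc 1 k, orderStat U j ≤ t j}

/-- `D_m(t,k) = C(m,k) (t_k)^k Ψ_{m-k}(1 - t_m, ..., 1 - t_{k+1})`. -/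
def distSU (m : ℕ) (t : ℕ → ℝ) (k : ℕ) : ℝ :=
  (m.choose k : ℝ) * t k ^ k * Psi (m - k) (fun j => 1 - t (m + 1 - j))

/-- `D̃_m(t,k) = C(m,k) (1 - t_{k+1})^{m-k} Ψ_k(t_1, ..., t_k)`. -/
def distSD (m : ℕ) (t : ℕ → ℝ) (k : ℕ) : ℝ :=
  (m.choose k : ℝ) * (1 - t (k + 1)) ^ (m - k) * Psi k t

/-- The mixture c.d.f. `G = π₀ F₀ + π₁ F₁`, with `π₁ = 1 - π₀`. -/
def mixture (π₀ : ℝ) (F₀ F₁ : ℝ → ℝ) (t : ℝ) : ℝ := π₀ * F₀ t + (1 - π₀) * F₁ t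

/-- Step-up formula for the c.d.f. of the FDP at `x`. -/
def suFDPcdf (m : ℕ) (π₀ : ℝ) (t : ℕ → ℝ) (x : ℝ) (F₀ F₁ : ℝ → ℝ) : ℝ :=
  let G := mixture π₀ F₀ F₁
  ∑ k ∈ Finset.range (m + 1), ∑ j ∈ Finset.range (⌊x * k⌋₊ + 1),
    (k.choose j : ℝ) * (π₀ * F₀ (t k) / G (t k)) ^ j * ((1 - π₀) * F₁ (t k) / G (t k)) ^ (k - j)
      * distSU m (fun i => G (t i)) k

/-- Step-up formula for the moment of order `s` of the FDP. -/
def suFDPmoment (m : ℕ) (π₀ : ℝ) (t : ℕ → ℝ) (s : ℕ) (F₀ F₁ : ℝ → ℝ) : ℝ :=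
  let G := mixture π₀ F₀ F₁
  ∑ l ∈ Finset.Icc 1 (min s m),
    (m.factorial : ℝ) / ((m - l).factorial : ℝ) * (Nat.stirlingSecond s l : ℝ) * π₀ ^ l
      * ∑ k ∈ Finset.Icc l m, F₀ (t k) ^ l / (k : ℝ) ^ s
          * distSU (m - l) (fun j => G (t (j + l))) (k - l)

/-- Step-up formula for the FDR. -/
def suFDR (m : ℕ) (π₀ : ℝ) (t : ℕ → ℝ) (F₀ F₁ : ℝ → ℝ) : ℝ :=
  let G := mixture π₀ F₀ F₁
  π₀ * m * ∑ k ∈ Finset.Icc 1 m, F₀ (t k) / (k : ℝ)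
    * distSU (m - 1) (fun j => G (t (j + 1))) (k - 1)

/-- Step-up formula for the power. -/
def suPower (m : ℕ) (π₀ : ℝ) (t : ℕ → ℝ) (F₀ F₁ : ℝ → ℝ) : ℝ :=
  let G := mixture π₀ F₀ F₁
  ∑ k ∈ Finset.Icc 1 m, F₁ (t k) * distSU (m - 1) (fun j => G (t (j + 1))) (k - 1)

/-- Step-down formula for the FDR. (If `G (t k) = 1`, the quotients below are `0 / 0`, read as `0`;
then the factor before them vanishes for `k < m`, and does not involve them for `k = m`.) -/
def sdFDR (m : ℕ) (π₀ : ℝ) (t : ℕ → ℝ) (F₀ F₁ : ℝ → ℝ) : ℝ :=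
  let G := mixture π₀ F₀ F₁
  π₀ * m * ∑ k ∈ Finset.Icc 1 m, ∑ k' ∈ Finset.Icc k m, F₀ (t k) / (k' : ℝ)
    * distSD (m - 1) (fun j => G (t j)) (k - 1)
    * distSD (m - k) (fun j => (G (t (k + j)) - G (t k)) / (1 - G (t k))) (k' - k)

/-- Step-down formula for the power. -/
def sdPower (m : ℕ) (π₀ : ℝ) (t : ℕ → ℝ) (F₀ F₁ : ℝ → ℝ) : ℝ :=
  let G := mixture π₀ F₀ F₁
  ∑ k ∈ Finset.Icc 1 m, F₁ (t k) * distSD (m - 1) (fun j => G (t j)) (k - 1)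

end

end StepwiseFDP

open StepwiseFDP

namespace StepwiseFDP

noncomputable section

open MeasureTheory ProbabilityTheory

/-! ### The Gaussian tail and its inverse -/

/-! An equicorrelated Gaussian vector is `√ρ W + √(1 - ρ) ξ_i` with one common factor `W` and
independent noises `ξ_i`. Writing `W` as the upper quantile of a uniform variable `u`, and attaching
to each index its indicator and its noise, makes the pairs (indicator, `p`-value) i.i.d. once `u` is
fixed, with null and non-null sub-distribution functions `π₀ F₀(·|u)` and `π₁ F₁(·|u)`
(`uncondEMN_eq_map`, `isMixtureModel_markedNoise`). By Fubini (`integral_uncondEMN`) it suffices to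
prove each formula for a fixed `u`, in an i.i.d. mixture model; integrability of the closed-form
integrands comes from the same argument.

For i.i.d. data, step-up rejects exactly `S` iff the points of `S` lie below level `#S` and the
points outside `S` satisfy count bounds at all higher levels (`isSUSet_iff`). These constraints bear
on disjoint coordinates, so the probability factorises; the second factor is a value of `Psi`,
because the probability of a counting event depends only on the masses of the nested levels
(`pi_real_lowerCount`). Splitting `S` by marks and grouping by cardinality gives the joint law of
the numbers of rejections and of marked rejections (`integral_SU`). The distribution of the FDP is
read off directly; its moments and the power follow from binomial factorial moments and Stirling
numbers (`sum_choose_moment`).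

Step-down is treated one hypothesis against the rest. If `S` is the step-down set among the indices
other than `i`, then `i` is rejected iff its `p`-value is at most `t (#S + 1)`; in that case the
procedure resumes among the remaining indices with levels `t (#S + 1 + j)` from which `t (#S + 1)`
has been cut off (`IsSDSet.insert_union`, `SD_eq_of_isSDSet`). The first pass alone gives the power
(`integral_indicator_mem_SD`). The FDR also needs the total number of rejections, hence the second
pass, whose probability is computed conditionally on exceeding level `#S + 1`
(`pi_real_lowerCount_of_subset`, `integral_SD`). This conditioning produces the quotients
`(G(t_{k+j}) - G(t_k)) / (1 - G(t_k))`. -/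

lemma gaussTail_coe (r : ℝ) : gaussTail r = (gaussianReal 0 1).real (Set.Ici r) := by
  simp [gaussTail, Set.Ici]

lemma gaussTail_top : gaussTail ⊤ = 0 := by simp [gaussTail]

lemma gaussTail_bot : gaussTail ⊥ = 1 := by simp [gaussTail]

lemma gaussTail_mem_Icc (z : EReal) : gaussTail z ∈ Set.Icc (0 : ℝ) 1 :=
  ⟨measureReal_nonneg, measureReal_le_one⟩

lemma gaussianReal_real_Ioo_pos {a b : ℝ} (h : a < b) :
    0 < (gaussianReal 0 1).real (Set.Ioo a b) := by
  rw [measureReal_def, ENNReal.toReal_pos_iff]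
  refine ⟨pos_iff_ne_zero.2 fun h0 => ?_, measure_lt_top _ _⟩
  have := gaussianReal_absolutelyContinuous' 0 one_ne_zero h0
  rw [Real.volume_Ioo, ENNReal.ofReal_eq_zero] at this
  linarith

/-- Between two extended reals lie two reals `r < r'`, and `(r, r')` has positive Gaussian mass: it
is counted by the larger tail and missed by the smaller one. -/
lemma gaussTail_strictAnti : StrictAnti gaussTail := by
  intro a b hab
  obtain ⟨r, har, hrb⟩ := EReal.lt_iff_exists_real_btwn.1 hab
  obtain ⟨r', hrr', hr'b⟩ := EReal.lt_iff_exists_real_btwn.1 hrb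
  have hpos := gaussianReal_real_Ioo_pos (EReal.coe_lt_coe_iff.1 hrr')
  have hdisj : Disjoint (Set.Ioo r r') {x : ℝ | b ≤ (x : EReal)} := by
    rw [Set.disjoint_left]
    intro x hx hbx
    exact absurd (EReal.coe_lt_coe_iff.1 (hr'b.trans_le hbx)) (not_lt.2 hx.2.le)
  have hmeas : MeasurableSet {x : ℝ | b ≤ (x : EReal)} :=
    measurableSet_le measurable_const measurable_coe_real_ereal
  have hle : (gaussianReal 0 1).real (Set.Ioo r r' ∪ {x : ℝ | b ≤ (x : EReal)}) ≤ gaussTail a := by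
    refine measureReal_mono ?_
    rintro x (hx | hx)
    · exact har.le.trans (EReal.coe_le_coe_iff.2 hx.1.le)
    · exact hab.le.trans hx
  rw [measureReal_union hdisj hmeas] at hle
  change _ + gaussTail b ≤ _ at hle
  linarith

lemma gaussTail_coe_mem_Ioo (r : ℝ) : gaussTail r ∈ Set.Ioo (0 : ℝ) 1 :=
  ⟨gaussTail_top ▸ gaussTail_strictAnti (EReal.coe_lt_top r),
    gaussTail_bot ▸ gaussTail_strictAnti (EReal.bot_lt_coe r)⟩

lemma continuous_cdf_gaussianReal : Continuous (cdf (gaussianReal 0 1)) := by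
  rw [continuous_iff_continuousAt]
  intro x
  rw [(monotone_cdf _).continuousAt_iff_leftLim_eq_rightLim, StieltjesFunction.rightLim_eq]
  have h0 : (cdf (gaussianReal 0 1)).measure {x} = 0 := by
    have := nullSingletonClass_gaussianReal (μ := 0) (v := 1) one_ne_zero
    rw [measure_cdf]; exact measure_singleton x
  rw [StieltjesFunction.measure_singleton, ENNReal.ofReal_eq_zero] at h0
  exact le_antisymm ((monotone_cdf _).leftLim_le le_rfl) (by linarith)

lemma gaussTail_eq_one_sub_cdf (r : ℝ) : gaussTail r = 1 - cdf (gaussianReal 0 1) r := by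
  have := nullSingletonClass_gaussianReal (μ := 0) (v := 1) one_ne_zero
  rw [gaussTail_coe, cdf_eq_real, ← probReal_compl_eq_one_sub measurableSet_Iic, Set.compl_Iic]
  exact measureReal_congr Ioi_ae_eq_Ici.symm

/-- The intermediate value theorem for the continuous c.d.f. covers `0 < t < 1`, and `±∞` supply the
endpoints. With strict monotonicity, this makes the supremum defining `gaussTailInv` a genuine
inverse on `[0,1]`. -/
lemma exists_gaussTail_eq {t : ℝ} (ht : t ∈ Set.Icc (0 : ℝ) 1) : ∃ z, gaussTail z = t := by
  rcases ht.1.eq_or_lt with rfl | h0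
  · exact ⟨⊤, gaussTail_top⟩
  rcases ht.2.eq_or_lt with rfl | h1
  · exact ⟨⊥, gaussTail_bot⟩
  have hmem : 1 - t ∈ Set.range (cdf (gaussianReal 0 1)) := by
    refine mem_range_of_exists_le_of_exists_ge continuous_cdf_gaussianReal ?_ ?_
    · exact (((tendsto_cdf_atBot _).eventually_lt_const (sub_pos.2 h1)).exists).imp fun _ => le_of_lt
    · exact (((tendsto_cdf_atTop _).eventually_const_lt (by linarith)).exists).imp fun _ => le_of_lt
  obtain ⟨r, hr⟩ := hmem
  exact ⟨r, by rw [gaussTail_eq_one_sub_cdf, hr]; ring⟩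

lemma gaussTailInv_gaussTail (z : EReal) : gaussTailInv (gaussTail z) = z := by
  have : {w : EReal | gaussTail z ≤ gaussTail w} = Set.Iic z := by
    ext w; exact gaussTail_strictAnti.le_iff_ge
  rw [gaussTailInv, this]
  exact isLUB_Iic.sSup_eq

lemma gaussTail_gaussTailInv {t : ℝ} (ht : t ∈ Set.Icc (0 : ℝ) 1) :
    gaussTail (gaussTailInv t) = t := by
  obtain ⟨z, rfl⟩ := exists_gaussTail_eq ht
  rw [gaussTailInv_gaussTail]

lemma gaussTail_le_iff {t : ℝ} (ht : t ∈ Set.Icc (0 : ℝ) 1) (z : EReal) :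
    gaussTail z ≤ t ↔ gaussTailInv t ≤ z := by
  conv_lhs => rw [← gaussTail_gaussTailInv ht]
  exact gaussTail_strictAnti.le_iff_ge

lemma le_gaussTail_iff {t : ℝ} (ht : t ∈ Set.Icc (0 : ℝ) 1) (z : EReal) :
    t ≤ gaussTail z ↔ z ≤ gaussTailInv t := by
  conv_lhs => rw [← gaussTail_gaussTailInv ht]
  exact gaussTail_strictAnti.le_iff_ge

lemma measurable_gaussTail : Measurable gaussTail := gaussTail_strictAnti.antitone.measurable

/-- The real-valued upper quantile function of the standard Gaussian law. -/
def gaussQuantile (u : ℝ) : ℝ := (gaussTailInv u).toReal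

lemma coe_gaussQuantile {u : ℝ} (hu : u ∈ Set.Ioo (0 : ℝ) 1) :
    (gaussQuantile u : EReal) = gaussTailInv u := by
  have h := gaussTail_gaussTailInv ⟨hu.1.le, hu.2.le⟩
  refine EReal.coe_toReal (fun htop => ?_) (fun hbot => ?_)
  · rw [htop, gaussTail_top] at h; exact hu.1.ne h
  · rw [hbot, gaussTail_bot] at h; exact hu.2.ne' h

lemma gaussTail_gaussQuantile {u : ℝ} (hu : u ∈ Set.Ioo (0 : ℝ) 1) :
    gaussTail (gaussQuantile u) = u := by
  rw [coe_gaussQuantile hu, gaussTail_gaussTailInv ⟨hu.1.le, hu.2.le⟩]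

lemma antitone_gaussTailInv : Antitone gaussTailInv := fun _ _ hab =>
  sSup_le_sSup fun _ hz => hab.trans hz

lemma measurable_gaussQuantile : Measurable gaussQuantile :=
  antitone_gaussTailInv.measurable.ereal_toReal

lemma volume_restrict_Ioo_real_Iic {s : ℝ} (hs : s ∈ Set.Icc (0 : ℝ) 1) :
    ((volume : Measure ℝ).restrict (Set.Ioo 0 1)).real (Set.Iic s) = s := by
  have h : ((volume : Measure ℝ).restrict (Set.Ioo 0 1)) = volume.restrict (Set.Ioc 0 1) :=
    Measure.restrict_congr_set Ioo_ae_eq_Ioc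
  rw [h, measureReal_restrict_apply measurableSet_Iic, Set.inter_comm, Set.Ioc_inter_Iic,
    min_eq_right hs.2, Real.volume_real_Ioc_of_le hs.1, sub_zero]

instance isProbabilityMeasure_restrict_Ioo :
    IsProbabilityMeasure ((volume : Measure ℝ).restrict (Set.Ioo 0 1)) :=
  ⟨by simp⟩

/-- Inverse transform sampling: for `u` in `(0,1)`, the quantile is at least `r` iff `u ≤ gaussTail
r`, an event of uniform probability `gaussTail r`. This is what turns the Gaussian common factor
into the variable `u` of the formulas. -/
lemma map_gaussQuantile :
    ((volume : Measure ℝ).restrict (Set.Ioo 0 1)).map gaussQuantile = gaussianReal 0 1 := by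
  have : IsProbabilityMeasure
      (((volume : Measure ℝ).restrict (Set.Ioo 0 1)).map gaussQuantile) :=
    Measure.isProbabilityMeasure_map measurable_gaussQuantile.aemeasurable
  refine Measure.ext_of_Ici _ _ fun r => ?_
  rw [← measureReal_eq_measureReal_iff,
    map_measureReal_apply measurable_gaussQuantile measurableSet_Ici, ← gaussTail_coe,
    ← volume_restrict_Ioo_real_Iic (gaussTail_mem_Icc r),
    measureReal_restrict_apply measurableSet_Iic,
    measureReal_restrict_apply (measurable_gaussQuantile measurableSet_Ici)]
  congr 1
  ext u
  simp only [Set.mem_inter_iff, Set.mem_preimage, Set.mem_Ici, Set.mem_Iic, and_congr_left_iff]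
  intro hu
  rw [← EReal.coe_le_coe_iff, ← gaussTail_strictAnti.le_iff_ge, gaussTail_gaussQuantile hu]

/-! ### The common factor representation of the equicorrelated model -/

/-- The law of a single indicator `H_i`. -/
def indicatorLaw (π₀ : ℝ) : Measure Bool :=
  ENNReal.ofReal π₀ • Measure.dirac false + ENNReal.ofReal (1 - π₀) • Measure.dirac true

lemma isProbabilityMeasure_indicatorLaw {π₀ : ℝ} (hπ₀ : π₀ ∈ Set.Icc (0 : ℝ) 1) :
    IsProbabilityMeasure (indicatorLaw π₀) := by
  constructor
  simp [indicatorLaw, ← ENNReal.ofReal_add hπ₀.1 (sub_nonneg.2 hπ₀.2)]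

lemma indicatorLaw_real_false {π₀ : ℝ} (hπ₀ : π₀ ∈ Set.Icc (0 : ℝ) 1) :
    (indicatorLaw π₀).real {false} = π₀ := by
  simp [indicatorLaw, measureReal_def, hπ₀.1]

lemma indicatorLaw_real_true {π₀ : ℝ} (hπ₀ : π₀ ∈ Set.Icc (0 : ℝ) 1) :
    (indicatorLaw π₀).real {true} = 1 - π₀ := by
  simp [indicatorLaw, measureReal_def, hπ₀.2]

/-- The law of a pair made of an indicator and an independent standard Gaussian noise. -/
def markedNoise (π₀ : ℝ) : Measure (Bool × ℝ) := (indicatorLaw π₀).prod (gaussianReal 0 1)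

/-- The `p`-value obtained from an indicator and a noise when the common factor is `u`. -/
def pvalue (ρ μ u : ℝ) (e : Bool × ℝ) : ℝ :=
  gaussTail ((√ρ * gaussQuantile u + √(1 - ρ) * e.2 + μ * (if e.1 then 1 else 0) : ℝ) : EReal)

lemma pvalue_pos (ρ μ u : ℝ) (e : Bool × ℝ) : 0 < pvalue ρ μ u e := (gaussTail_coe_mem_Ioo _).1

lemma measurable_pvalue (ρ μ : ℝ) :
    Measurable fun z : ℝ × (Bool × ℝ) => pvalue ρ μ z.1 z.2 := by
  unfold pvalue
  refine measurable_gaussTail.comp (measurable_coe_real_ereal.comp ?_)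
  have h1 : Measurable fun z : ℝ × (Bool × ℝ) => gaussQuantile z.1 :=
    measurable_gaussQuantile.comp measurable_fst
  have h2 : Measurable fun z : ℝ × (Bool × ℝ) => (if z.2.1 then (1 : ℝ) else 0) :=
    (measurable_of_countable fun b : Bool => if b then (1 : ℝ) else 0).comp
      (measurable_fst.comp measurable_snd)
  fun_prop

/-- The argument `z` is extended because the quantile of a threshold equal to `0` or `1` is
infinite. Taking `b = 0` serves `condF0`, and `b = μ` serves `condF1`. -/
lemma ereal_div_le_iff (z : EReal) (a b x : ℝ) {c : ℝ} (hc : 0 < c) :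
    (z - a - b) / (c : EReal) ≤ x ↔ z ≤ ((a + c * x + b : ℝ) : EReal) := by
  induction z with
  | bot => simp [EReal.bot_div_of_pos_ne_top (EReal.coe_pos.2 hc) (EReal.coe_ne_top c)]
  | top =>
    simp only [EReal.top_sub_coe, EReal.top_div_of_pos_ne_top (EReal.coe_pos.2 hc)
      (EReal.coe_ne_top c), top_le_iff]
    exact iff_of_false (EReal.coe_ne_top _) (EReal.coe_ne_top _)
  | coe r =>
    rw [← EReal.coe_sub, ← EReal.coe_sub, ← EReal.coe_div, EReal.coe_le_coe_iff,
      EReal.coe_le_coe_iff, div_le_iff₀ hc]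
    constructor <;> intro h <;> linarith

/-- For `ρ < 1`, solve `p ≤ t` for the noise. For `ρ = 1` the noise has coefficient `0`, so the null
`p`-value is `u` itself and the probability is an indicator. -/
lemma gaussianReal_pvalue_false {ρ u t : ℝ} (μ : ℝ) (hρ : ρ ∈ Set.Icc (0 : ℝ) 1)
    (hu : u ∈ Set.Ioo (0 : ℝ) 1) (ht : t ∈ Set.Icc (0 : ℝ) 1) :
    (gaussianReal 0 1).real {ξ | pvalue ρ μ u (false, ξ) ≤ t} = condF0 ρ u t := by
  unfold condF0
  split_ifs with h1 h2
  · subst h1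
    simp [pvalue, gaussTail_gaussQuantile hu, h2]
  · subst h1
    simp [pvalue, gaussTail_gaussQuantile hu, h2]
  · rw [gaussTail]
    congr 1
    ext ξ
    have hc : 0 < √(1 - ρ) := Real.sqrt_pos.2 (sub_pos.2 (lt_of_le_of_ne hρ.2 h1))
    have := ereal_div_le_iff (gaussTailInv t) (√ρ * gaussQuantile u) 0 ξ hc
    simp only [EReal.coe_zero, sub_zero, EReal.coe_mul, coe_gaussQuantile hu] at this
    simp only [Set.mem_ofPred_eq, pvalue, gaussTail_le_iff ht]
    rw [this]
    simp

lemma gaussianReal_pvalue_true {ρ u t : ℝ} (μ : ℝ) (hρ : ρ ∈ Set.Icc (0 : ℝ) 1)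
    (hu : u ∈ Set.Ioo (0 : ℝ) 1) (ht : t ∈ Set.Icc (0 : ℝ) 1) :
    (gaussianReal 0 1).real {ξ | pvalue ρ μ u (true, ξ) ≤ t} = condF1 ρ μ u t := by
  have key : gaussTail ((gaussQuantile u + μ : ℝ) : EReal) ≤ t ↔
      u ≤ gaussTail (gaussTailInv t - μ) := by
    rw [gaussTail_le_iff ht, le_gaussTail_iff ⟨hu.1.le, hu.2.le⟩, ← coe_gaussQuantile hu]
    have := ereal_div_le_iff (gaussTailInv t) μ 0 (gaussQuantile u) one_pos
    simp only [EReal.coe_zero, sub_zero, EReal.coe_one, div_one, one_mul, add_zero] at this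
    rw [this, add_comm]
  rw [EReal.coe_add] at key
  unfold condF1
  split_ifs with h1 h2
  · subst h1
    simp [pvalue, key, h2]
  · subst h1
    simp [pvalue, key, h2]
  · rw [gaussTail]
    congr 1
    ext ξ
    have hc : 0 < √(1 - ρ) := Real.sqrt_pos.2 (sub_pos.2 (lt_of_le_of_ne hρ.2 h1))
    have := ereal_div_le_iff (gaussTailInv t) (√ρ * gaussQuantile u) μ ξ hc
    rw [EReal.coe_mul, coe_gaussQuantile hu] at this
    simp only [Set.mem_ofPred_eq, pvalue, gaussTail_le_iff ht]
    rw [this]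
    simp

lemma markedNoise_pvalue_false {π₀ ρ u t : ℝ} (μ : ℝ) (hπ₀ : π₀ ∈ Set.Icc (0 : ℝ) 1)
    (hρ : ρ ∈ Set.Icc (0 : ℝ) 1) (hu : u ∈ Set.Ioo (0 : ℝ) 1) (ht : t ∈ Set.Icc (0 : ℝ) 1) :
    (markedNoise π₀).real {e | e.1 = false ∧ pvalue ρ μ u e ≤ t} = π₀ * condF0 ρ u t := by
  have := isProbabilityMeasure_indicatorLaw hπ₀
  have hset : {e : Bool × ℝ | e.1 = false ∧ pvalue ρ μ u e ≤ t} =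
      {false} ×ˢ {ξ | pvalue ρ μ u (false, ξ) ≤ t} := by
    ext ⟨b, ξ⟩
    cases b <;> simp
  rw [hset, markedNoise, measureReal_prod_prod, indicatorLaw_real_false hπ₀,
    gaussianReal_pvalue_false μ hρ hu ht]

lemma markedNoise_pvalue_true {π₀ ρ u t : ℝ} (μ : ℝ) (hπ₀ : π₀ ∈ Set.Icc (0 : ℝ) 1)
    (hρ : ρ ∈ Set.Icc (0 : ℝ) 1) (hu : u ∈ Set.Ioo (0 : ℝ) 1) (ht : t ∈ Set.Icc (0 : ℝ) 1) :
    (markedNoise π₀).real {e | e.1 = true ∧ pvalue ρ μ u e ≤ t} = (1 - π₀) * condF1 ρ μ u t := by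
  have := isProbabilityMeasure_indicatorLaw hπ₀
  have hset : {e : Bool × ℝ | e.1 = true ∧ pvalue ρ μ u e ≤ t} =
      {true} ×ˢ {ξ | pvalue ρ μ u (true, ξ) ≤ t} := by
    ext ⟨b, ξ⟩
    cases b <;> simp
  rw [hset, markedNoise, measureReal_prod_prod, indicatorLaw_real_true hπ₀,
    gaussianReal_pvalue_true μ hρ hu ht]

/-- The matrix is `ρ` times the all-ones matrix plus `1 - ρ` times the identity. The resulting
quadratic form gives both positive semidefiniteness and the characteristic function. -/
lemma dotProduct_equicorrMatrix_mulVec {m : ℕ} (ρ : ℝ) (x : Fin m → ℝ) :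
    x ⬝ᵥ (equicorrMatrix m ρ).mulVec x = ρ * (∑ i, x i) ^ 2 + (1 - ρ) * ∑ i, x i ^ 2 := by
  have h : equicorrMatrix m ρ = ρ • Matrix.vecMulVec 1 1 + (1 - ρ) • 1 := by
    ext i j
    by_cases hij : i = j <;> simp [equicorrMatrix, Matrix.vecMulVec, hij]
  rw [h, Matrix.add_mulVec, Matrix.smul_mulVec, Matrix.smul_mulVec, Matrix.one_mulVec,
    dotProduct_add, dotProduct_smul, dotProduct_smul, Matrix.vecMulVec_mulVec]
  simp [dotProduct, sq, Finset.sum_mul]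

lemma posSemidef_equicorrMatrix {ρ : ℝ} (m : ℕ) (hρ : ρ ∈ Set.Icc (0 : ℝ) 1) :
    (equicorrMatrix m ρ).PosSemidef := by
  refine Matrix.PosSemidef.of_dotProduct_mulVec_nonneg ?_ fun x => ?_
  · ext i j
    simp [equicorrMatrix, eq_comm]
  · have h1 := sub_nonneg.2 hρ.2
    have h0 := hρ.1
    rw [star_trivial, dotProduct_equicorrMatrix_mulVec]
    positivity

/-- Compare characteristic functions. The exponential of the inner product splits into a factor in
the common variable and one factor per noise, and the product of the Gaussian characteristic
functions recovers the quadratic form. -/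
lemma multivariateGaussian_equicorrMatrix {ρ : ℝ} (m : ℕ) (hρ : ρ ∈ Set.Icc (0 : ℝ) 1) :
    multivariateGaussian 0 (equicorrMatrix m ρ) =
      ((gaussianReal 0 1).prod (Measure.pi fun _ : Fin m => gaussianReal 0 1)).map
        fun z => WithLp.toLp 2 fun i => √ρ * z.1 + √(1 - ρ) * z.2 i := by
  have hmeas : Measurable fun z : ℝ × (Fin m → ℝ) =>
      (WithLp.toLp 2 fun i => √ρ * z.1 + √(1 - ρ) * z.2 i : EuclideanSpace ℝ (Fin m)) := by
    fun_prop
  have := Measure.isProbabilityMeasure_map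
    (μ := (gaussianReal 0 1).prod (Measure.pi fun _ : Fin m => gaussianReal 0 1)) hmeas.aemeasurable
  refine Measure.ext_of_charFun (funext fun x => ?_)
  rw [charFun_multivariateGaussian (posSemidef_equicorrMatrix m hρ),
    charFun_apply, integral_map hmeas.aemeasurable (by fun_prop)]
  have hexp : ∀ z : ℝ × (Fin m → ℝ),
      Complex.exp ((inner ℝ (WithLp.toLp 2 fun i => √ρ * z.1 + √(1 - ρ) * z.2 i) x : ℝ)
          * Complex.I) =
        Complex.exp (((√ρ * ∑ i, x i : ℝ) : ℂ) * z.1 * Complex.I) *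
          ∏ i, Complex.exp (((√(1 - ρ) * x i : ℝ) : ℂ) * z.2 i * Complex.I) := by
    intro z
    rw [← Complex.exp_sum, ← Complex.exp_add, ← Finset.sum_mul, ← add_mul]
    congr 2
    rw [PiLp.inner_apply]
    push_cast
    simp only [RCLike.inner_apply, conj_trivial]
    push_cast
    rw [Finset.mul_sum, Finset.sum_mul, ← Finset.sum_add_distrib]
    exact Finset.sum_congr rfl fun i _ => by ring
  simp_rw [hexp]
  rw [integral_prod_mul (fun w : ℝ => Complex.exp (((√ρ * ∑ i, x i : ℝ) : ℂ) * w * Complex.I))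
      (fun z : Fin m → ℝ => ∏ i, Complex.exp (((√(1 - ρ) * x i : ℝ) : ℂ) * z i * Complex.I)),
    integral_fintype_prod_eq_prod
      (f := fun (i : Fin m) (y : ℝ) => Complex.exp (((√(1 - ρ) * x i : ℝ) : ℂ) * y * Complex.I))]
  simp_rw [← charFun_apply_real, charFun_gaussianReal]
  rw [← Complex.exp_sum, ← Complex.exp_add]
  congr 1
  simp only [inner_zero_right, Complex.ofReal_zero, zero_mul, zero_sub, mul_zero, NNReal.coe_one,
    Complex.ofReal_one, one_mul, dotProduct_equicorrMatrix_mulVec]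
  rw [Finset.sum_neg_distrib, ← Finset.sum_div]
  simp_rw [← Complex.ofReal_pow, mul_pow, Real.sq_sqrt hρ.1, Real.sq_sqrt (sub_nonneg.2 hρ.2)]
  push_cast
  rw [← Finset.mul_sum]
  ring

/-- The `p`-value vector generated from the common factor and the individual noises. -/
lemma condEMN_eq_map {m : ℕ} {ρ : ℝ} (μ : ℝ) (hρ : ρ ∈ Set.Icc (0 : ℝ) 1) (H : Fin m → Bool) :
    condEMN ρ μ H =
      (((volume : Measure ℝ).restrict (Set.Ioo 0 1)).prod
        (Measure.pi fun _ : Fin m => gaussianReal 0 1)).map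
          fun z i => pvalue ρ μ z.1 (H i, z.2 i) := by
  have h2 : Measurable fun X : EuclideanSpace ℝ (Fin m) => fun i =>
      gaussTail ((X i + μ * (if H i then 1 else 0) : ℝ) : EReal) :=
    measurable_pi_lambda _ fun i => measurable_gaussTail.comp
      (measurable_coe_real_ereal.comp (by fun_prop))
  rw [condEMN, multivariateGaussian_equicorrMatrix m hρ, ← map_gaussQuantile]
  have h3 : (((volume : Measure ℝ).restrict (Set.Ioo 0 1)).map gaussQuantile).prod
        (Measure.pi fun _ : Fin m => gaussianReal 0 1) =
      (((volume : Measure ℝ).restrict (Set.Ioo 0 1)).prod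
        (Measure.pi fun _ : Fin m => gaussianReal 0 1)).map (Prod.map gaussQuantile id) := by
    rw [← Measure.map_prod_map _ _ measurable_gaussQuantile measurable_id, Measure.map_id]
  have h4 : Measurable (Prod.map gaussQuantile (id : (Fin m → ℝ) → _)) :=
    measurable_gaussQuantile.prodMap measurable_id
  -- The earlier reverse rewrite also hit the noises; this undoes it everywhere. Now `h3` presents
  -- the Gaussian factor and the noises as an image of the uniform variable and the noises.
  rw [map_gaussQuantile] at h3 ⊢
  rw [h3, Measure.map_map h2 (by fun_prop), Measure.map_map (h2.comp (by fun_prop)) h4]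
  rfl

/-- The model draws `H` first and then the factor and noises. Tonelli exchanges `H` with `u`, and
regrouping coordinates turns the indicators and the noises into i.i.d. pairs, so that conditioning
on `u` leaves an i.i.d. sample. -/
lemma uncondEMN_eq_map (m : ℕ) {π₀ ρ : ℝ} (μ : ℝ) (hπ₀ : π₀ ∈ Set.Icc (0 : ℝ) 1)
    (hρ : ρ ∈ Set.Icc (0 : ℝ) 1) :
    uncondEMN m π₀ ρ μ =
      (((volume : Measure ℝ).restrict (Set.Ioo 0 1)).prod
        (Measure.pi fun _ : Fin m => markedNoise π₀)).map
          fun z => (fun i => (z.2 i).1, fun i => pvalue ρ μ z.1 (z.2 i)) := by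
  have hπ := isProbabilityMeasure_indicatorLaw hπ₀
  have hνm : IsProbabilityMeasure (markedNoise π₀) := by unfold markedNoise; infer_instance
  have hprior : prior m π₀ = Measure.pi fun _ => indicatorLaw π₀ := rfl
  have hT : Measurable fun z : ℝ × (Fin m → Bool × ℝ) =>
      ((fun i => (z.2 i).1, fun i => pvalue ρ μ z.1 (z.2 i)) : (Fin m → Bool) × (Fin m → ℝ)) := by
    refine Measurable.prodMk (by fun_prop) (measurable_pi_lambda _ fun i => ?_)
    exact (measurable_pvalue ρ μ).comp (f := fun z : ℝ × (Fin m → Bool × ℝ) => (z.1, z.2 i))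
      (by fun_prop)
  have hcond : ∀ H : Fin m → Bool, Measurable fun z : ℝ × (Fin m → ℝ) =>
      fun i => pvalue ρ μ z.1 (H i, z.2 i) := fun H =>
    measurable_pi_lambda _ fun i => (measurable_pvalue ρ μ).comp
      (f := fun z : ℝ × (Fin m → ℝ) => (z.1, (H i, z.2 i))) (by fun_prop)
  have hκ : IsSFiniteKernel (Kernel.ofFunOfCountable (condEMN (m := m) ρ μ)) := by
    have : IsMarkovKernel (Kernel.ofFunOfCountable (condEMN (m := m) ρ μ)) := by
      refine ⟨fun H => ?_⟩
      change IsProbabilityMeasure (condEMN ρ μ H)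
      rw [condEMN_eq_map μ hρ]
      exact Measure.isProbabilityMeasure_map (hcond H).aemeasurable
    infer_instance
  have hpi : (Measure.pi fun _ : Fin m => markedNoise π₀) =
      ((Measure.pi fun _ : Fin m => indicatorLaw π₀).prod
        (Measure.pi fun _ : Fin m => gaussianReal 0 1)).map
          (MeasurableEquiv.arrowProdEquivProdArrow Bool ℝ (Fin m)).symm :=
    ((measurePreserving_arrowProdEquivProdArrow Bool ℝ (Fin m) (fun _ => indicatorLaw π₀)
      fun _ => gaussianReal 0 1).symm _).map_eq.symm
  ext s hs
  rw [uncondEMN, hprior, Measure.compProd_apply hs, Measure.map_apply hT hs,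
    Measure.prod_apply (hT hs)]
  have hL : ∀ H : Fin m → Bool,
      Kernel.ofFunOfCountable (condEMN (m := m) ρ μ) H (Prod.mk H ⁻¹' s) =
      ∫⁻ u in Set.Ioo (0 : ℝ) 1, (Measure.pi fun _ : Fin m => gaussianReal 0 1)
        {ξ | (H, fun i => pvalue ρ μ u (H i, ξ i)) ∈ s} := by
    intro H
    change condEMN ρ μ H (Prod.mk H ⁻¹' s) = _
    have hs' : MeasurableSet (Prod.mk H ⁻¹' s) := measurable_prodMk_left hs
    rw [condEMN_eq_map μ hρ, Measure.map_apply (hcond H) hs', Measure.prod_apply (hcond H hs')]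
    rfl
  have hR : ∀ u : ℝ, (Measure.pi fun _ : Fin m => markedNoise π₀) (Prod.mk u ⁻¹'
        ((fun z : ℝ × (Fin m → Bool × ℝ) =>
          (fun i => (z.2 i).1, fun i => pvalue ρ μ z.1 (z.2 i))) ⁻¹' s)) =
      ∫⁻ H, (Measure.pi fun _ : Fin m => gaussianReal 0 1)
        {ξ | (H, fun i => pvalue ρ μ u (H i, ξ i)) ∈ s} ∂(Measure.pi fun _ => indicatorLaw π₀) := by
    intro u
    have hs' := measurable_prodMk_left (x := u) (hT hs)
    rw [hpi, Measure.map_apply (MeasurableEquiv.measurable _) hs',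
      Measure.prod_apply (MeasurableEquiv.measurable _ hs')]
    rfl
  simp_rw [hL, hR]
  -- Joint measurability in `(H, u)` may be checked for each fixed `H`, since there are countably
  -- many configurations.
  refine lintegral_lintegral_swap (Measurable.aemeasurable ?_)
  refine measurable_from_prod_countable_right fun H => ?_
  exact measurable_measure_prodMk_left (hcond H (measurable_prodMk_left (x := H) hs))

/-! ### Rejection sets characterised by counts -/

section Counting

variable {ι E : Type*}

open Classical in
/-- The number of indices in `S` at which the family `x` takes its values in `A`. -/
def cnt (S : Finset ι) (A : Set E) (x : ι → E) : ℕ := (S.filter fun i => x i ∈ A).card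

lemma cnt_mono {S T : Finset ι} {A B : Set E} (hST : S ⊆ T) (hAB : A ⊆ B) (x : ι → E) :
    cnt S A x ≤ cnt T B x := by
  classical
  exact Finset.card_le_card fun i hi => by
    rw [Finset.mem_filter] at hi ⊢
    exact ⟨hST hi.1, hAB hi.2⟩

lemma cnt_le_card (S : Finset ι) (A : Set E) (x : ι → E) : cnt S A x ≤ S.card := by
  classical exact Finset.card_filter_le _ _

lemma cnt_eq_card_iff {S : Finset ι} {A : Set E} {x : ι → E} :
    cnt S A x = S.card ↔ ∀ i ∈ S, x i ∈ A := by
  classical exact Finset.card_filter_eq_iff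

lemma cnt_eq_zero_iff {S : Finset ι} {A : Set E} {x : ι → E} :
    cnt S A x = 0 ↔ ∀ i ∈ S, x i ∉ A := by
  classical
  rw [cnt, Finset.card_eq_zero, Finset.filter_eq_empty_iff]

lemma cnt_union [DecidableEq ι] {S T : Finset ι} (h : Disjoint S T) (A : Set E) (x : ι → E) :
    cnt (S ∪ T) A x = cnt S A x + cnt T A x := by
  classical
  rw [cnt, Finset.filter_union, Finset.card_union_of_disjoint
    (Finset.disjoint_filter_filter h)]
  rfl

lemma cnt_add_cnt_compl (S : Finset ι) (A : Set E) (x : ι → E) :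
    cnt S A x + cnt S Aᶜ x = S.card := by
  classical
  rw [cnt, cnt, ← Finset.card_filter_add_card_filter_not (s := S) fun i => x i ∈ A]
  congr

lemma cnt_congr {S : Finset ι} (A : Set E) {x y : ι → E} (h : ∀ i ∈ S, x i = y i) :
    cnt S A x = cnt S A y := by
  classical
  exact congrArg Finset.card (Finset.filter_congr fun i hi => by rw [h i hi])

lemma measurable_cnt [MeasurableSpace E] (S : Finset ι) {A : Set E} (hA : MeasurableSet A) :
    Measurable (cnt (ι := ι) S A) := by
  classical
  have : cnt (ι := ι) S A = fun x => ∑ i ∈ S, if x i ∈ A then 1 else 0 := by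
    funext x; rw [cnt, Finset.card_filter]
  rw [this]
  exact Finset.measurable_sum _ fun i _ =>
    Measurable.ite (measurable_pi_apply i hA) measurable_const measurable_const

/-- At each level `j ≤ #S`, at least `j` of the `x i`, `i ∈ S`, lie in `A j`. -/
def LowerCount (S : Finset ι) (A : ℕ → Set E) (x : ι → E) : Prop :=
  ∀ j ∈ Set.Icc 1 S.card, j ≤ cnt S (A j) x

/-- At each level `j ≤ #S`, fewer than `j` of the `x i`, `i ∈ S`, lie in `A j`. -/
def UpperCount (S : Finset ι) (A : ℕ → Set E) (x : ι → E) : Prop :=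
  ∀ j ∈ Set.Icc 1 S.card, cnt S (A j) x < j

/-- Fewer than `j` points in a set means at least `#S + 1 - j` points outside it. This reversal of
levels is the origin of the arguments `1 - t_m, ..., 1 - t_{k+1}` of `Psi` in `distSU`. -/
lemma upperCount_iff_lowerCount (S : Finset ι) (A : ℕ → Set E) (x : ι → E) :
    UpperCount S A x ↔ LowerCount S (fun j => (A (S.card + 1 - j))ᶜ) x := by
  constructor
  · intro h j hj
    have h1 := h (S.card + 1 - j) ⟨by have := hj.2; omega, by have := hj.1; omega⟩
    have h2 := cnt_add_cnt_compl S (A (S.card + 1 - j)) x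
    have := hj.2
    beta_reduce
    omega
  · intro h j hj
    have h1 := h (S.card + 1 - j) ⟨by have := hj.2; omega, by have := hj.1; omega⟩
    have h2 := cnt_add_cnt_compl S (A j) x
    have h3 : S.card + 1 - (S.card + 1 - j) = j := by have := hj.2; omega
    simp only [h3] at h1
    have := hj.2
    omega

lemma LowerCount.mem {S : Finset ι} {A : ℕ → Set E} {x : ι → E} (h : LowerCount S A x) {i : ι}
    (hi : i ∈ S) : x i ∈ A S.card :=
  cnt_eq_card_iff.1 (le_antisymm (cnt_le_card _ _ _)
    (h S.card ⟨Finset.card_pos.2 ⟨i, hi⟩, le_rfl⟩)) i hi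

lemma lowerCount_congr {S : Finset ι} (A : ℕ → Set E) {x y : ι → E} (h : ∀ i ∈ S, x i = y i) :
    LowerCount S A x ↔ LowerCount S A y :=
  forall₂_congr fun j _ => by rw [cnt_congr (A j) h]

lemma measurableSet_lowerCount [MeasurableSpace E] (S : Finset ι) {A : ℕ → Set E}
    (hA : ∀ j ∈ Set.Icc 1 S.card, MeasurableSet (A j)) :
    MeasurableSet {x : ι → E | LowerCount S A x} := by
  have : {x : ι → E | LowerCount S A x} =
      ⋂ j ∈ Set.Icc 1 S.card, {x | j ≤ cnt S (A j) x} := by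
    ext x; simp [LowerCount]
  rw [this]
  exact MeasurableSet.biInter (Set.to_countable _) fun j hj =>
    measurableSet_le measurable_const (measurable_cnt S (hA j hj))

variable [DecidableEq ι]

/-- The set `S` is the rejection set of the step-up procedure with acceptance levels `A`. -/
def IsSUSet [Fintype ι] (A : ℕ → Set E) (x : ι → E) (S : Finset ι) : Prop :=
  (∀ i ∈ S, x i ∈ A S.card) ∧ UpperCount Sᶜ (fun j => A (S.card + j)) x

/-- The set `S` is the rejection set, among the hypotheses of `T`, of the step-down procedure with
acceptance levels `A`. -/
def IsSDSet (T : Finset ι) (A : ℕ → Set E) (x : ι → E) (S : Finset ι) : Prop :=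
  S ⊆ T ∧ LowerCount S A x ∧ ∀ i ∈ T \ S, x i ∉ A (S.card + 1)

/-- The point is `#S = k`: level `k` contains at least `k` points, while `S` sits inside level `k +
1`, which contains at most `k`. Equality then leaves no point of level `k + 1` outside `S`. The
clause `1 ≤ k` makes `S` empty for `k = 0`, whatever `A 0` is. -/
lemma isSDSet_of_index {T : Finset ι} {A : ℕ → Set E} {x : ι → E} {k : ℕ}
    (hA : MonotoneOn A (Set.Icc 1 T.card)) (hk : k ≤ T.card)
    (h1 : ∀ j ∈ Set.Icc 1 k, j ≤ cnt T (A j) x)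
    (h2 : k < T.card → cnt T (A (k + 1)) x < k + 1) {S : Finset ι}
    (hS : ∀ i, i ∈ S ↔ i ∈ T ∧ 1 ≤ k ∧ x i ∈ A k) : IsSDSet T A x S := by
  classical
  have hST : S ⊆ T := fun i hi => ((hS i).1 hi).1
  have hmono : ∀ {i j}, 1 ≤ i → i ≤ j → j ≤ T.card → A i ⊆ A j := fun hi hij hj =>
    hA ⟨hi, hij.trans hj⟩ ⟨hi.trans hij, hj⟩ hij
  have hSf : 1 ≤ k → S = T.filter fun i => x i ∈ A k := fun h => by
    ext i; simp [hS, h]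
  have hsub : k < T.card → S ⊆ T.filter fun i => x i ∈ A (k + 1) := fun hlt i hi => by
    obtain ⟨h, h', h''⟩ := (hS i).1 hi
    exact Finset.mem_filter.2 ⟨h, hmono h' (Nat.le_succ k) hlt h''⟩
  have hcard : S.card = k := by
    refine le_antisymm ?_ ?_
    · rcases hk.eq_or_lt with rfl | hlt
      · exact Finset.card_le_card hST
      · exact (Finset.card_le_card (hsub hlt)).trans (Nat.lt_succ_iff.1 (h2 hlt))
    · rcases Nat.eq_zero_or_pos k with rfl | hpos
      · exact Nat.zero_le _
      · rw [hSf hpos]; exact h1 k ⟨hpos, le_rfl⟩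
  refine ⟨hST, fun j hj => ?_, fun i hi hmem => ?_⟩
  · rw [hcard] at hj
    refine (h1 j hj).trans (Finset.card_le_card fun i hi => ?_)
    rw [Finset.mem_filter] at hi ⊢
    exact ⟨(hS i).2 ⟨hi.1, hj.1.trans hj.2, hmono hj.1 hj.2 hk hi.2⟩, hi.2⟩
  · rw [Finset.mem_sdiff] at hi
    rw [hcard] at hmem
    have hlt : k < T.card := by
      rw [← hcard]
      exact Finset.card_lt_card ⟨hST, fun h => hi.2 (h hi.1)⟩
    have heq := Finset.eq_of_subset_of_card_le (hsub hlt)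
      ((Nat.lt_succ_iff.1 (h2 hlt)).trans hcard.ge)
    exact hi.2 (heq ▸ Finset.mem_filter.2 ⟨hi.1, hmem⟩)

lemma exists_isSDSet {T : Finset ι} {A : ℕ → Set E} (hA : MonotoneOn A (Set.Icc 1 T.card))
    (x : ι → E) : ∃ S, IsSDSet T A x S := by
  classical
  set k := Nat.findGreatest (fun k => ∀ j ∈ Set.Icc 1 k, j ≤ cnt T (A j) x) T.card with hkdef
  have hk : k ≤ T.card := Nat.findGreatest_le _
  have h1 : ∀ j ∈ Set.Icc 1 k, j ≤ cnt T (A j) x :=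
    Nat.findGreatest_spec (P := fun k => ∀ j ∈ Set.Icc 1 k, j ≤ cnt T (A j) x) (Nat.zero_le _)
      (fun j hj => absurd (hj.1.trans hj.2) (by omega))
  refine ⟨T.filter fun i => 1 ≤ k ∧ x i ∈ A k, isSDSet_of_index hA hk h1 (fun hlt => ?_)
    (fun i => by simp)⟩
  by_contra hcon
  refine Nat.findGreatest_is_greatest (P := fun k => ∀ j ∈ Set.Icc 1 k, j ≤ cnt T (A j) x)
    (Nat.lt_succ_self k) hlt fun j hj => ?_
  rcases Nat.eq_or_lt_of_le hj.2 with rfl | hj'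
  · exact not_lt.1 hcon
  · exact h1 j ⟨hj.1, Nat.lt_succ_iff.1 hj'⟩

/-- A larger `S'` would put at least `#S + 1` points of `T` in level `#S + 1`. But no point of `T \
S` lies there, and `S` itself supplies only `#S`. -/
lemma IsSDSet.card_le {T : Finset ι} {A : ℕ → Set E} {x : ι → E} {S S' : Finset ι}
    (h : IsSDSet T A x S) (h' : IsSDSet T A x S') : S'.card ≤ S.card := by
  by_contra! hlt
  have h1 := h'.2.1 (S.card + 1) ⟨by omega, hlt⟩
  have h2 : cnt (T \ S) (A (S.card + 1)) x = 0 := cnt_eq_zero_iff.2 h.2.2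
  have h3 : cnt T (A (S.card + 1)) x = cnt S (A (S.card + 1)) x + 0 := by
    rw [← h2, ← cnt_union Finset.disjoint_sdiff, Finset.union_sdiff_of_subset h.1]
  have h4 := cnt_mono h'.1 (le_refl (A (S.card + 1))) x
  have h5 := cnt_le_card S (A (S.card + 1)) x
  omega

lemma IsSDSet.unique {T : Finset ι} {A : ℕ → Set E} {x : ι → E} {S S' : Finset ι}
    (hA : MonotoneOn A (Set.Icc 1 T.card)) (h : IsSDSet T A x S) (h' : IsSDSet T A x S') :
    S = S' := by
  have hc : S'.card = S.card := le_antisymm (h.card_le h') (h'.card_le h)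
  refine Finset.eq_of_subset_of_card_le (fun i hi => ?_) hc.le
  by_contra hn
  have hT := h.1 hi
  have hlt : S'.card < T.card := Finset.card_lt_card ⟨h'.1, fun hs => hn (hs hT)⟩
  have hpos : 1 ≤ S.card := Finset.card_pos.2 ⟨i, hi⟩
  refine h'.2.2 i (Finset.mem_sdiff.2 ⟨hT, hn⟩) ?_
  rw [hc]
  exact hA ⟨hpos, by omega⟩ ⟨by omega, by omega⟩ (Nat.le_succ _) (h.2.1.mem hi)

variable [Fintype ι]

lemma IsSDSet.of_erase_of_notMem {A : ℕ → Set E} {x : ι → E} {S : Finset ι} {i : ι}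
    (h : IsSDSet (Finset.univ.erase i) A x S) (hi : x i ∉ A (S.card + 1)) :
    IsSDSet Finset.univ A x S := by
  refine ⟨Finset.subset_univ _, h.2.1, fun l hl => ?_⟩
  rcases eq_or_ne l i with rfl | hne
  · exact hi
  · exact h.2.2 l (by simpa [hne] using hl)

/-- The restart mechanism. Once `i` passes at level `#S + 1`, the points of `insert i S` fill all
counts up to that level and stay in every higher one. The others lie outside that level, so further
rejections are governed by the levels with `A (S.card + 1)` removed. -/
lemma IsSDSet.insert_union {A : ℕ → Set E} {x : ι → E} {S S' : Finset ι} {i : ι}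
    (hA : MonotoneOn A (Set.Icc 1 (Fintype.card ι)))
    (h : IsSDSet (Finset.univ.erase i) A x S) (hi : x i ∈ A (S.card + 1))
    (h' : IsSDSet (Finset.univ.erase i \ S)
      (fun j => A (S.card + 1 + j) \ A (S.card + 1)) x S') :
    (insert i (S ∪ S')).card = S.card + 1 + S'.card ∧
      IsSDSet Finset.univ A x (insert i (S ∪ S')) := by
  have hiS : i ∉ S := fun hs => by simpa using h.1 hs
  have hiS' : i ∉ S' := fun hs => by simpa using h'.1 hs
  have hdisj : Disjoint S S' :=
    Finset.disjoint_left.2 fun l hl hl' => (Finset.mem_sdiff.1 (h'.1 hl')).2 hl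
  have hdisj' : Disjoint (insert i S) S' := by
    rw [Finset.disjoint_insert_left]; exact ⟨hiS', hdisj⟩
  have hcS : (insert i S).card = S.card + 1 := Finset.card_insert_of_notMem hiS
  have hcard : (insert i (S ∪ S')).card = S.card + 1 + S'.card := by
    rw [← Finset.insert_union, Finset.card_union_of_disjoint hdisj', hcS]
  have hle : S.card + 1 + S'.card ≤ Fintype.card ι := by
    rw [← hcard]; exact Finset.card_le_univ _
  have hall : ∀ l ∈ insert i S, x l ∈ A (S.card + 1) := by
    intro l hl
    rcases Finset.mem_insert.1 hl with rfl | hl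
    · exact hi
    · have hpos : 1 ≤ S.card := Finset.card_pos.2 ⟨l, hl⟩
      exact hA ⟨hpos, by omega⟩ ⟨by omega, by omega⟩ (Nat.le_succ _) (h.2.1.mem hl)
  refine ⟨hcard, Finset.subset_univ _, fun j hj => ?_, fun l hl => ?_⟩
  · rw [hcard] at hj
    rw [← Finset.insert_union, cnt_union hdisj']
    rcases Nat.lt_or_ge S.card j with hlt | hge
    · have hsub : A (S.card + 1) ⊆ A j := hA ⟨by omega, by omega⟩ ⟨by omega, by have := hj.2; omega⟩ hlt
      have h1 : cnt (insert i S) (A j) x = S.card + 1 := by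
        rw [← hcS]; exact cnt_eq_card_iff.2 fun l hl => hsub (hall l hl)
      rcases Nat.eq_or_lt_of_le hlt with heq | hlt'
      · omega
      · have h2 := h'.2.1 (j - (S.card + 1)) ⟨by omega, by have := hj.2; omega⟩
        beta_reduce at h2
        rw [show S.card + 1 + (j - (S.card + 1)) = j by omega] at h2
        have h3 := cnt_mono (le_refl S') (Set.sdiff_subset (s := A j) (t := A (S.card + 1))) x
        omega
    · have h1 := h.2.1 j ⟨hj.1, hge⟩
      have h2 := cnt_mono (Finset.subset_insert i S) (le_refl (A j)) x
      omega
  · rw [hcard]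
    have hl' : l ≠ i ∧ l ∉ S ∧ l ∉ S' := by simpa using hl
    have hlS : l ∈ Finset.univ.erase i \ S := by simp [hl'.1, hl'.2.1]
    intro hmem
    exact h'.2.2 l (Finset.mem_sdiff.2 ⟨hlS, hl'.2.2⟩) ⟨hmem, h.2.2 l hlS⟩

end Counting

/-! ### Step-up and step-down procedures as counting sets -/

section Procedures

variable {m : ℕ} {E : Type*}

lemma orderStat_le_iff (p : Fin m → ℝ) {k : ℕ} (hk : k ∈ Set.Icc 1 m) (s : ℝ) :
    orderStat p k ≤ s ↔ k ≤ cnt Finset.univ (Set.Iic s) p := by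
  classical
  have hlt : k - 1 < m := by have := hk.1; have := hk.2; omega
  have h := Tuple.lt_card_le_iff_apply_le_of_monotone (f := p ∘ Tuple.sort p) (a := s)
    (j := ⟨k - 1, hlt⟩) (Tuple.monotone_sort p)
  have hcard : (Finset.univ.filter fun i => (p ∘ Tuple.sort p) i ≤ s).card =
      cnt Finset.univ (Set.Iic s) p := by
    refine Finset.card_equiv (Tuple.sort p) fun i => ?_
    simp
  rw [hcard] at h
  rw [orderStat, dif_pos (show 1 ≤ k ∧ k ≤ m from hk)]
  refine h.symm.trans ?_
  have := hk.1
  simp only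
  omega

lemma orderStat_zero (p : Fin m → ℝ) : orderStat p 0 = 0 := by simp [orderStat]

/-- The level sets `{p ≤ t j}` of a `p`-value function. -/
def levelSet (p : E → ℝ) (t : ℕ → ℝ) (j : ℕ) : Set E := {e | p e ≤ t j}

lemma cnt_levelSet (p : E → ℝ) (t : ℕ → ℝ) (j : ℕ) (x : Fin m → E) :
    cnt Finset.univ (Set.Iic (t j)) (fun i => p (x i)) = cnt Finset.univ (levelSet p t j) x := rfl

lemma IsThreshold.monotoneOn {t : ℕ → ℝ} (ht : IsThreshold m t) :
    MonotoneOn t (Set.Icc 0 m) := by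
  intro i hi j hj hij
  rcases Nat.eq_zero_or_pos i with rfl | hi0
  · rcases Nat.eq_zero_or_pos j with rfl | hj0
    · exact le_rfl
    · rw [ht.zero]; exact (ht.mem_Icc j ⟨hj0, hj.2⟩).1
  · exact ht.mono ⟨hi0, hi.2⟩ ⟨hi0.trans_le hij, hj.2⟩ hij

lemma IsThreshold.mem_Icc' {t : ℕ → ℝ} (ht : IsThreshold m t) {k : ℕ} (hk : k ≤ m) :
    t k ∈ Set.Icc (0 : ℝ) 1 := by
  rcases Nat.eq_zero_or_pos k with rfl | h
  · simp [ht.zero]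
  · exact ht.mem_Icc k ⟨h, hk⟩

lemma IsThreshold.monotoneOn_levelSet {t : ℕ → ℝ} (ht : IsThreshold m t) (p : E → ℝ) :
    MonotoneOn (levelSet p t) (Set.Icc 0 m) := fun _ hi _ hj hij _ he =>
  le_trans he (ht.monotoneOn hi hj hij)

lemma mem_SU {t : ℕ → ℝ} {p : Fin m → ℝ} {i : Fin m} : i ∈ SU t p ↔ p i ≤ t (stepUpIndex t p) := by
  simp [SU]

lemma mem_SD {t : ℕ → ℝ} {p : Fin m → ℝ} {i : Fin m} :
    i ∈ SD t p ↔ p i ≤ t (stepDownIndex t p) := by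
  simp [SD]

/-- The condition on `S` puts at least `#S` points in level `#S`; that on `Sᶜ` puts fewer than `n`
points in each level `n > #S`. Together they say that `#S` is the maximal index. -/
lemma isSUSet_iff {t : ℕ → ℝ} (ht : IsThreshold m t) (p : E → ℝ) (x : Fin m → E)
    (S : Finset (Fin m)) :
    IsSUSet (levelSet p t) x S ↔ SU t (fun i => p (x i)) = S := by
  classical
  set q : Fin m → ℝ := fun i => p (x i) with hq
  have hmono := ht.monotoneOn_levelSet p
  have hcompl : ∀ S : Finset (Fin m), S.card + Sᶜ.card = m := fun S => by
    rw [Finset.card_add_card_compl, Fintype.card_fin]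
  have hsplit : ∀ (S : Finset (Fin m)) (A : Set E), cnt Finset.univ A x = cnt S A x + cnt Sᶜ A x :=
    fun S A => by rw [← cnt_union disjoint_compl_right, Finset.union_compl]
  constructor
  · rintro ⟨h1, h2⟩
    have hc := hcompl S
    have hk : stepUpIndex t q = S.card := by
      refine Nat.findGreatest_eq_iff.2 ⟨by omega, fun h0 => ?_, fun n hn hnm => ?_⟩
      · rw [orderStat_le_iff q ⟨Nat.pos_of_ne_zero h0, by omega⟩, cnt_levelSet,
          hsplit S, cnt_eq_card_iff.2 h1]
        exact Nat.le_add_right _ _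
      · rw [orderStat_le_iff q ⟨by omega, hnm⟩, cnt_levelSet, hsplit S]
        have := h2 (n - S.card) ⟨by omega, by omega⟩
        beta_reduce at this
        rw [show S.card + (n - S.card) = n by omega] at this
        have := cnt_le_card S (levelSet p t n) x
        omega
    ext i
    rw [mem_SU, hk]
    refine ⟨fun hi => ?_, fun hi => h1 i hi⟩
    by_contra hn
    have hpos : 0 < Sᶜ.card := Finset.card_pos.2 ⟨i, Finset.mem_compl.2 hn⟩
    have h3 := cnt_eq_zero_iff.1 (Nat.lt_one_iff.1 (h2 1 ⟨le_rfl, hpos⟩)) i (Finset.mem_compl.2 hn)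
    exact h3 (hmono ⟨Nat.zero_le _, by omega⟩ ⟨Nat.zero_le _, by omega⟩ (Nat.le_succ _) hi)
  · rintro rfl
    set k := stepUpIndex t q with hk
    obtain ⟨hkm, hP, hnP⟩ := Nat.findGreatest_eq_iff.1 hk.symm
    have hmem : ∀ i, i ∈ SU t q ↔ x i ∈ levelSet p t k := fun i => mem_SU
    have hnP' : ∀ n, k < n → n ≤ m → cnt Finset.univ (levelSet p t n) x < n := fun n hn hnm => by
      have := hnP hn hnm
      rw [orderStat_le_iff q ⟨by omega, hnm⟩, cnt_levelSet] at this
      omega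
    have hcnt : (SU t q).card = cnt Finset.univ (levelSet p t k) x := by
      rw [cnt]; congr 1
    have hcard : (SU t q).card = k := by
      refine le_antisymm ?_ ?_
      -- With more than `k` rejections, level `k + 1` would already hold at least `k + 1` points,
      -- against the maximality of `k`.
      · by_contra! hlt
        have hle : (SU t q).card ≤ m := by have := hcompl (SU t q); omega
        have h1 := hnP' (k + 1) (Nat.lt_succ_self k) (by omega)
        have h2 := cnt_mono (le_refl Finset.univ) (hmono (a := k) (b := k + 1) ⟨by omega, by omega⟩
          ⟨by omega, by omega⟩ (Nat.le_succ _)) x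
        omega
      · rcases Nat.eq_zero_or_pos k with h0 | hpos
        · omega
        · have := hP hpos.ne'
          rw [orderStat_le_iff q ⟨hpos, hkm⟩, cnt_levelSet] at this
          omega
    refine ⟨fun i hi => by rw [hcard]; exact (hmem i).1 hi, fun j hj => ?_⟩
    have hc := hcompl (SU t q)
    have hj2 := hj.2
    have hj1 := hj.1
    rw [hcard]
    beta_reduce
    have h1 := hnP' (k + j) (by omega) (by omega)
    have hsub : levelSet p t k ⊆ levelSet p t (k + j) :=
      hmono ⟨by omega, hkm⟩ ⟨by omega, by omega⟩ (Nat.le_add_right _ _)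
    rw [hsplit (SU t q), cnt_eq_card_iff.2 fun i hi => hsub ((hmem i).1 hi)] at h1
    omega

lemma isSDSet_SD {t : ℕ → ℝ} (ht : IsThreshold m t) {p : E → ℝ} (hp : ∀ e, 0 < p e)
    (x : Fin m → E) :
    IsSDSet Finset.univ (levelSet p t) x (SD t fun i => p (x i)) := by
  classical
  set q : Fin m → ℝ := fun i => p (x i) with hq
  set k := stepDownIndex t q with hk
  have hkm : k ≤ m := Nat.findGreatest_le _
  have hP : ∀ j ≤ k, orderStat q j ≤ t j :=
    Nat.findGreatest_spec (P := fun k => ∀ k' ≤ k, orderStat q k' ≤ t k') (Nat.zero_le _)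
      (fun j hj => by rw [Nat.le_zero.1 hj, orderStat_zero, ht.zero])
  refine isSDSet_of_index (k := k) ?_ (by simpa using hkm) (fun j hj => ?_) (fun hlt => ?_)
    fun i => ?_
  · rw [Finset.card_univ, Fintype.card_fin]
    exact (ht.monotoneOn_levelSet p).mono (Set.Icc_subset_Icc_left zero_le_one)
  · rw [← cnt_levelSet, ← orderStat_le_iff _ ⟨hj.1, hj.2.trans hkm⟩]
    exact hP j hj.2
  · rw [Finset.card_univ, Fintype.card_fin] at hlt
    by_contra! hcon
    rw [← cnt_levelSet, ← orderStat_le_iff _ ⟨by omega, hlt⟩] at hcon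
    refine Nat.findGreatest_is_greatest (P := fun k => ∀ k' ≤ k, orderStat q k' ≤ t k')
      (Nat.lt_succ_self k) hlt fun j hj => ?_
    rcases Nat.eq_or_lt_of_le hj with rfl | hj'
    · exact hcon
    · exact hP j (Nat.lt_succ_iff.1 hj')
  · rw [mem_SD]
    refine ⟨fun hi => ⟨Finset.mem_univ _, ?_, hi⟩, fun hi => hi.2.2⟩
    -- Positivity of the `p`-values enters here: at index `0` the threshold is `0`, and nothing is
    -- rejected.
    by_contra! h0
    have hk0 : stepDownIndex t q = 0 := Nat.lt_one_iff.1 h0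
    rw [hk0, ht.zero] at hi
    exact absurd hi (not_le.2 (hp _))

end Procedures

/-! ### Counting events under product measures -/

section ExitLevel

variable {E : Type*}

open Classical in
/-- The number of levels `j ≤ n` at which `e` does not lie in `A j`. -/
def exitLevel (n : ℕ) (A : ℕ → Set E) (e : E) : ℕ :=
  ((Finset.Icc 1 n).filter fun j => e ∉ A j).card

/-- For nested levels, those missed by `e` form an initial segment, so the number of missed levels
encodes all memberships of `e` in a single integer. -/
lemma exitLevel_lt_iff {n : ℕ} {A : ℕ → Set E} (hA : MonotoneOn A (Set.Icc 1 n)) (e : E) {j : ℕ}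
    (hj : j ∈ Set.Icc 1 n) : exitLevel n A e < j ↔ e ∈ A j := by
  classical
  constructor
  · intro h
    by_contra hn
    have hsub : Finset.Icc 1 j ⊆ (Finset.Icc 1 n).filter fun j => e ∉ A j := fun i hi => by
      rw [Finset.mem_Icc] at hi
      refine Finset.mem_filter.2 ⟨Finset.mem_Icc.2 ⟨hi.1, hi.2.trans hj.2⟩, fun hmem => hn ?_⟩
      exact hA ⟨hi.1, hi.2.trans hj.2⟩ hj hi.2 hmem
    have := Finset.card_le_card hsub
    rw [Nat.card_Icc] at this
    rw [exitLevel] at h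
    omega
  · intro h
    have hsub : ((Finset.Icc 1 n).filter fun j => e ∉ A j) ⊆ Finset.Icc 1 (j - 1) := fun i hi => by
      rw [Finset.mem_filter, Finset.mem_Icc] at hi
      rw [Finset.mem_Icc]
      refine ⟨hi.1.1, ?_⟩
      by_contra hlt
      exact hi.2 (hA hj hi.1 (by omega) h)
    have := Finset.card_le_card hsub
    rw [Nat.card_Icc] at this
    have := hj.1
    rw [exitLevel]
    omega

lemma exitLevel_le (n : ℕ) (A : ℕ → Set E) (e : E) : exitLevel n A e ≤ n := by
  classical
  exact (Finset.card_filter_le _ _).trans (by simp)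

end ExitLevel

section ProductLaw

variable {ι E : Type*} [Fintype ι] [MeasurableSpace E]

/-- An event depending only on a block of coordinates is a preimage under restriction to that block:
`σ` extends a block by a constant, and the event does not see the difference. Independence of
disjoint blocks then applies. -/
lemma pi_real_inter_of_disjoint (ν : Measure E) [IsProbabilityMeasure ν] {S T : Finset ι}
    (hST : Disjoint S T) {F₁ F₂ : Set (ι → E)} (hF₁ : MeasurableSet F₁) (hF₂ : MeasurableSet F₂)
    (h₁ : ∀ x y : ι → E, (∀ i ∈ S, x i = y i) → x ∈ F₁ → y ∈ F₁)
    (h₂ : ∀ x y : ι → E, (∀ i ∈ T, x i = y i) → x ∈ F₂ → y ∈ F₂) :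
    (Measure.pi fun _ : ι => ν).real (F₁ ∩ F₂) =
      (Measure.pi fun _ : ι => ν).real F₁ * (Measure.pi fun _ : ι => ν).real F₂ := by
  classical
  obtain ⟨e₀⟩ := ν.nonempty_of_neZero
  let σ : (U : Finset ι) → (U → E) → ι → E := fun U y i => if h : i ∈ U then y ⟨i, h⟩ else e₀
  have hσ : ∀ U, Measurable (σ U) := fun U => measurable_pi_lambda _ fun i => by
    by_cases h : i ∈ U
    · simpa [σ, h] using measurable_pi_apply _
    · simp [σ, h]
  have hσr : ∀ (U : Finset ι) (x : ι → E), ∀ i ∈ U, x i = σ U (fun j => x j) i :=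
    fun U x i hi => by simp [σ, hi]
  have hpre : ∀ (U : Finset ι) {F : Set (ι → E)},
      (∀ x y : ι → E, (∀ i ∈ U, x i = y i) → x ∈ F → y ∈ F) →
      F = (fun (x : ι → E) (j : U) => x j) ⁻¹' (σ U ⁻¹' F) := fun U F hF => by
    ext x
    exact ⟨hF _ _ (hσr U x), hF _ _ fun i hi => (hσr U x i hi).symm⟩
  have hind : iIndepFun (fun (i : ι) (x : ι → E) => x i) (Measure.pi fun _ : ι => ν) :=
    iIndepFun_pi (X := fun _ => id) fun _ => aemeasurable_id
  have := (hind.indepFun_finset S T hST fun i => measurable_pi_apply i).measure_inter_preimage_eq_mul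
    _ _ (hσ S hF₁) (hσ T hF₂)
  rw [← hpre S h₁, ← hpre T h₂] at this
  rw [measureReal_def, this, ENNReal.toReal_mul]
  rfl

lemma pi_real_forall_mem (ν : Measure E) [IsProbabilityMeasure ν] (S : Finset ι)
    (B : ι → Set E) :
    (Measure.pi fun _ : ι => ν).real {x | ∀ i ∈ S, x i ∈ B i} = ∏ i ∈ S, ν.real (B i) := by
  have : {x : ι → E | ∀ i ∈ S, x i ∈ B i} = (S : Set ι).pi B := rfl
  rw [this, measureReal_def, Measure.pi_pi_finset, ENNReal.toReal_prod]
  rfl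

lemma measurable_exitLevel {n : ℕ} {A : ℕ → Set E} (hA : ∀ j ∈ Set.Icc 1 n, MeasurableSet (A j)) :
    Measurable (exitLevel n A) := by
  classical
  have : exitLevel n A = fun e => ∑ j ∈ Finset.Icc 1 n, if e ∉ A j then 1 else 0 := by
    funext e; rw [exitLevel, Finset.card_filter]
  rw [this]
  exact Finset.measurable_sum _ fun j hj =>
    Measurable.ite (hA j (Finset.mem_Icc.1 hj)).compl measurable_const measurable_const

/-- The c.d.f. of the exit level at `j < n` is the mass of level `j + 1`, and it is `1` from `n` on;
so its law depends on the level masses only. -/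
lemma map_exitLevel_eq {E' : Type*} [MeasurableSpace E'] (ν : Measure E) [IsProbabilityMeasure ν]
    (ν' : Measure E') [IsProbabilityMeasure ν'] {n : ℕ} {A : ℕ → Set E} {A' : ℕ → Set E'}
    (hA : MonotoneOn A (Set.Icc 1 n)) (hA' : MonotoneOn A' (Set.Icc 1 n))
    (hmA : ∀ j ∈ Set.Icc 1 n, MeasurableSet (A j)) (hmA' : ∀ j ∈ Set.Icc 1 n, MeasurableSet (A' j))
    (h : ∀ j ∈ Set.Icc 1 n, ν.real (A j) = ν'.real (A' j)) :
    ν.map (exitLevel n A) = ν'.map (exitLevel n A') := by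
  have hm := measurable_exitLevel hmA
  have hm' := measurable_exitLevel hmA'
  have := Measure.isProbabilityMeasure_map (μ := ν) hm.aemeasurable
  refine Measure.ext_of_Iic _ _ fun j => ?_
  rw [Measure.map_apply hm measurableSet_Iic, Measure.map_apply hm' measurableSet_Iic]
  rcases Nat.lt_or_ge j n with hlt | hge
  · have hj : j + 1 ∈ Set.Icc 1 n := ⟨by omega, hlt⟩
    have h1 : exitLevel n A ⁻¹' Set.Iic j = A (j + 1) := by
      ext e; rw [← exitLevel_lt_iff hA e hj, Nat.lt_succ_iff]; rfl
    have h2 : exitLevel n A' ⁻¹' Set.Iic j = A' (j + 1) := by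
      ext e; rw [← exitLevel_lt_iff hA' e hj, Nat.lt_succ_iff]; rfl
    rw [h1, h2, ← measureReal_eq_measureReal_iff, h _ hj]
  · have h1 : exitLevel n A ⁻¹' Set.Iic j = Set.univ := by
      ext e; simpa using (exitLevel_le n A e).trans hge
    have h2 : exitLevel n A' ⁻¹' Set.Iic j = Set.univ := by
      ext e; simpa using (exitLevel_le n A' e).trans hge
    rw [h1, h2, measure_univ, measure_univ]

/-- The probability of a lower counting event, read off the exit levels. -/
lemma pi_real_lowerCount_eq_map (ν : Measure E) [IsProbabilityMeasure ν] {n : ℕ} {S : Finset ι}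
    (hS : S.card = n) {A : ℕ → Set E} (hA : MonotoneOn A (Set.Icc 1 n))
    (hmA : ∀ j ∈ Set.Icc 1 n, MeasurableSet (A j)) :
    (Measure.pi fun _ : ι => ν).real {x | LowerCount S A x} =
      (Measure.pi fun _ : Fin n => ν.map (exitLevel n A)).real
        {c | LowerCount Finset.univ (fun j => Set.Iio j) c} := by
  classical
  let e : Fin n ≃ S := (finCongr hS.symm).trans S.equivFin.symm
  have hm := measurable_exitLevel hmA
  have hind : iIndepFun (fun (a : Fin n) (x : ι → E) => exitLevel n A (x (e a)))
      (Measure.pi fun _ : ι => ν) :=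
    (iIndepFun_pi (μ := fun _ : ι => ν) (X := fun _ => exitLevel n A)
      fun _ => hm.aemeasurable).precomp (g := fun a => (e a : ι))
        (Subtype.val_injective.comp e.injective)
  have hmap := hind.map_fun_eq_pi_map fun a => (hm.comp (measurable_pi_apply _)).aemeasurable
  have hmarg : ∀ a : Fin n, (Measure.pi fun _ : ι => ν).map
      (fun x => exitLevel n A (x (e a))) = ν.map (exitLevel n A) := fun a => by
    rw [← (measurePreserving_eval (fun _ : ι => ν) (e a)).map_eq,
      Measure.map_map hm (measurable_pi_apply _), (measurePreserving_eval (fun _ : ι => ν) (e a)).map_eq]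
    rfl
  rw [← (hmap.trans (congrArg Measure.pi (funext hmarg))), map_measureReal_apply (by fun_prop)
    (measurableSet_lowerCount _ fun j _ => measurableSet_Iio)]
  congr 1
  ext x
  simp only [Set.mem_ofPred_eq, Set.mem_preimage, LowerCount, Finset.card_univ, Fintype.card_fin, hS]
  refine forall₂_congr fun j hj => ?_
  have : cnt Finset.univ (Set.Iio j) (fun a => exitLevel n A (x (e a))) = cnt S (A j) x := by
    refine Finset.card_nbij (fun a => (e a : ι)) (fun a ha => ?_) (fun a _ b _ hab => ?_)
      (fun i hi => ?_)
    · simp only [Finset.coe_filter, Finset.mem_univ, true_and, Set.mem_Iio, Set.mem_ofPred_eq] at ha ⊢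
      exact ⟨(e a).2, (exitLevel_lt_iff hA _ hj).1 ha⟩
    · exact e.injective (Subtype.ext hab)
    · simp only [Finset.coe_filter, Set.mem_ofPred_eq] at hi
      refine ⟨e.symm ⟨i, hi.1⟩, ?_, by simp⟩
      simpa using (exitLevel_lt_iff hA _ hj).2 hi.2
  rw [← this]
  rfl

/-- The lower counting events of an i.i.d. sample have the probability of the corresponding event
for uniform order statistics. -/
lemma pi_real_lowerCount (ν : Measure E) [IsProbabilityMeasure ν] {n : ℕ} {S : Finset ι}
    (hS : S.card = n) {A : ℕ → Set E} (hA : MonotoneOn A (Set.Icc 1 n))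
    (hmA : ∀ j ∈ Set.Icc 1 n, MeasurableSet (A j)) {s : ℕ → ℝ}
    (hs : ∀ j ∈ Set.Icc 1 n, ν.real (A j) = s j) :
    (Measure.pi fun _ : ι => ν).real {x | LowerCount S A x} = Psi n s := by
  have hsmono : MonotoneOn (fun j => Set.Iic (s j)) (Set.Icc 1 n) := fun i hi j hj hij => by
    refine Set.Iic_subset_Iic.2 ?_
    rw [← hs i hi, ← hs j hj]
    exact measureReal_mono (hA hi hj hij)
  have hunif : ∀ j ∈ Set.Icc 1 n, ν.real (A j) =
      ((volume : Measure ℝ).restrict (Set.Ioo 0 1)).real (Set.Iic (s j)) := fun j hj => by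
    rw [volume_restrict_Ioo_real_Iic, hs j hj]
    rw [← hs j hj]
    exact ⟨measureReal_nonneg, measureReal_le_one⟩
  have hPsi : Psi n s = (Measure.pi fun _ : Fin n => (volume : Measure ℝ).restrict (Set.Ioo 0 1)).real
      {U | LowerCount Finset.univ (fun j => Set.Iic (s j)) U} := by
    rw [Psi]
    congr 1
    ext U
    simp only [Set.mem_ofPred_eq, LowerCount, Finset.card_univ, Fintype.card_fin]
    exact forall₂_congr fun j hj => orderStat_le_iff U hj _
  -- Both probabilities are the same functional of the exit-level law, and the two laws agree
  -- because the level masses agree. No continuity of `ν` is needed.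
  rw [hPsi, pi_real_lowerCount_eq_map ν hS hA hmA,
    pi_real_lowerCount_eq_map _ (by simp) hsmono fun _ _ => measurableSet_Iic,
    map_exitLevel_eq ν _ hA hsmono hmA (fun _ _ => measurableSet_Iic) hunif]

lemma Psi_congr {n : ℕ} {s s' : ℕ → ℝ} (h : ∀ j ∈ Set.Icc 1 n, s j = s' j) : Psi n s = Psi n s' := by
  rw [Psi, Psi]
  congr 1
  ext U
  exact forall₂_congr fun j hj => by rw [h j hj]

lemma Psi_zero (s : ℕ → ℝ) : Psi 0 s = 1 := by
  have : {U : Fin 0 → ℝ | ∀ j ∈ Set.Icc 1 0, orderStat U j ≤ s j} = Set.univ := by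
    ext U; simp
  rw [Psi, this, probReal_univ]

lemma pi_real_smul (ν : Measure E) [IsFiniteMeasure ν] (c : ENNReal) (hc : c ≠ ⊤)
    (F : Set (ι → E)) :
    (Measure.pi fun _ : ι => c • ν).real F =
      c.toReal ^ Fintype.card ι * (Measure.pi fun _ : ι => ν).real F := by
  have hfin : IsFiniteMeasure (c • ν) := ν.smul_finite hc
  have : (Measure.pi fun _ : ι => c • ν) = c ^ Fintype.card ι • Measure.pi fun _ : ι => ν := by
    refine Measure.pi_eq fun s _ => ?_
    simp [Measure.pi_pi, Finset.prod_mul_distrib]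
  rw [this]
  simp

/-- Lower counting events whose levels are contained in a set `C`: the probabilities may be
computed conditionally on `C`. -/
lemma pi_real_lowerCount_of_subset (ν : Measure E) [IsProbabilityMeasure ν] {n : ℕ} {S : Finset ι}
    (hS : S.card = n) {A : ℕ → Set E} (hA : MonotoneOn A (Set.Icc 1 n))
    (hmA : ∀ j ∈ Set.Icc 1 n, MeasurableSet (A j)) {C : Set E} (hC : MeasurableSet C)
    (hAC : ∀ j ∈ Set.Icc 1 n, A j ⊆ C) :
    (Measure.pi fun _ : ι => ν).real {x | LowerCount S A x} =
      ν.real C ^ n * Psi n fun j => ν.real (A j) / ν.real C := by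
  rcases Nat.eq_zero_or_pos n with rfl | hn
  · rw [pi_real_lowerCount ν hS hA hmA fun _ _ => rfl, Psi_zero, Psi_zero]
    simp
  -- For a null `C` conditioning is meaningless, but both sides vanish: since `n > 0`, the event
  -- forces points into `C`.
  rcases eq_or_ne (ν C) 0 with h0 | h0
  · have hsub : {x | LowerCount S A x} ⊆ {x | ∀ i ∈ S, x i ∈ C} := fun x hx i hi =>
      hAC S.card ⟨by omega, hS.le⟩ (hx.mem hi)
    have h1 := measureReal_mono (μ := Measure.pi fun _ : ι => ν) hsub
    rw [pi_real_forall_mem ν S fun _ => C, Finset.prod_const, hS] at h1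
    have hC0 : ν.real C = 0 := by simp [measureReal_def, h0]
    rw [hC0, zero_pow hn.ne'] at h1 ⊢
    rw [zero_mul]
    exact le_antisymm h1 measureReal_nonneg
  · have : IsProbabilityMeasure (ν[|C]) := ProbabilityTheory.cond_isProbabilityMeasure h0
    have hrestr : ν.restrict C = ν C • ν[|C] := by
      rw [ProbabilityTheory.cond, smul_smul, ENNReal.mul_inv_cancel h0 (measure_ne_top _ _), one_smul]
    have hPsi := pi_real_lowerCount (ι := Fin n) ν[|C] (S := Finset.univ) (by simp) hA hmA
      (s := fun j => ν.real (A j) / ν.real C) fun j hj => by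
        rw [measureReal_def, cond_apply hC, Set.inter_eq_right.2 (hAC j hj), ENNReal.toReal_mul,
          ENNReal.toReal_inv, div_eq_inv_mul]
        rfl
    rw [pi_real_lowerCount ν hS hA hmA fun _ _ => rfl, ← hPsi,
      ← pi_real_lowerCount (ι := Fin n) ν (S := Finset.univ) (by simp) hA hmA fun _ _ => rfl]
    have hF : MeasurableSet {x : Fin n → E | LowerCount Finset.univ A x} :=
      measurableSet_lowerCount _ (by simpa using hmA)
    have hsub : {x : Fin n → E | LowerCount Finset.univ A x} ⊆ Set.univ.pi fun _ => C :=
      fun x hx i _ => hAC _ (by simp; omega) (hx.mem (Finset.mem_univ i))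
    -- The event lies in `C ^ n`. There the product measure is the product of the restrictions `ν C
    -- • ν[|C]`, and the scalars give the factor `ν.real C ^ n`.
    have := pi_real_smul (ι := Fin n) ν[|C] (ν C) (measure_ne_top _ _)
      {x | LowerCount Finset.univ A x}
    rw [← hrestr, ← Measure.restrict_pi_pi, measureReal_restrict_apply hF,
      Set.inter_eq_left.2 hsub, Fintype.card_fin] at this
    exact this

end ProductLaw

/-! ### One-versus-rest decomposition of the step-down procedure -/

section OneVersusRest

variable {m : ℕ} {E : Type*}

lemma IsThreshold.monotoneOn_levelSet_of_card_le {t : ℕ → ℝ} (ht : IsThreshold m t) (p : E → ℝ)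
    {n : ℕ} (hn : n ≤ m) : MonotoneOn (levelSet p t) (Set.Icc 1 n) :=
  (ht.monotoneOn_levelSet p).mono fun _ hj => ⟨Nat.zero_le _, hj.2.trans hn⟩

lemma IsThreshold.monotoneOn_levelSet_sdiff {t : ℕ → ℝ} (ht : IsThreshold m t) (p : E → ℝ)
    {n k : ℕ} (hn : k + n ≤ m) :
    MonotoneOn (fun j => levelSet p t (k + j) \ levelSet p t k) (Set.Icc 1 n) :=
  fun _ hi _ hj hij => Set.sdiff_subset_sdiff_left
    (ht.monotoneOn_levelSet p ⟨Nat.zero_le _, by have := hi.2; omega⟩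
      ⟨Nat.zero_le _, by have := hj.2; omega⟩ (by omega))

lemma card_univ_erase_sdiff {i : Fin m} {S : Finset (Fin m)} (hS : S ⊆ Finset.univ.erase i) :
    (Finset.univ.erase i \ S).card = m - 1 - S.card := by
  rw [Finset.card_sdiff_of_subset hS, Finset.card_erase_of_mem (Finset.mem_univ i),
    Finset.card_univ, Fintype.card_fin]

lemma card_add_one_le {i : Fin m} {S : Finset (Fin m)} (hS : S ⊆ Finset.univ.erase i) :
    S.card + 1 ≤ m := by
  have := Finset.card_le_card hS
  rw [Finset.card_erase_of_mem (Finset.mem_univ i), Finset.card_univ, Fintype.card_fin] at this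
  have := i.pos
  omega

/-- Rejection of `i` by the step-down procedure is decided by the number of rejections among the
other hypotheses; the full rejection set is obtained by running the procedure a second time. -/
lemma SD_eq_of_isSDSet {t : ℕ → ℝ} (ht : IsThreshold m t) {p : E → ℝ} (hp : ∀ e, 0 < p e)
    {x : Fin m → E} {i : Fin m} {S : Finset (Fin m)}
    (hS : IsSDSet (Finset.univ.erase i) (levelSet p t) x S) :
    (i ∈ SD t (fun i => p (x i)) ↔ x i ∈ levelSet p t (S.card + 1)) ∧
    ∀ S', x i ∈ levelSet p t (S.card + 1) → IsSDSet (Finset.univ.erase i \ S)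
      (fun j => levelSet p t (S.card + 1 + j) \ levelSet p t (S.card + 1)) x S' →
      (SD t fun i => p (x i)).card = S.card + 1 + S'.card := by
  have hmono : MonotoneOn (levelSet p t) (Set.Icc 1 (Finset.univ : Finset (Fin m)).card) :=
    ht.monotoneOn_levelSet_of_card_le p (by simp)
  have hSD := isSDSet_SD ht hp x
  have hmono' : MonotoneOn (levelSet p t) (Set.Icc 1 (Fintype.card (Fin m))) :=
    ht.monotoneOn_levelSet_of_card_le p (by simp)
  have hcard := card_univ_erase_sdiff hS.1
  have hle := card_add_one_le hS.1
  refine ⟨⟨fun hi => ?_, fun hi => ?_⟩, fun S' hi hS' => ?_⟩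
  -- Were `i` to fail at level `#S + 1`, then `S`, which omits `i`, would be the full rejection set.
  · by_contra hn
    have := hSD.unique hmono (hS.of_erase_of_notMem hn)
    rw [this] at hi
    simpa using hS.1 hi
  · obtain ⟨S', hS'⟩ := exists_isSDSet (T := Finset.univ.erase i \ S)
      (A := fun j => levelSet p t (S.card + 1 + j) \ levelSet p t (S.card + 1))
      (ht.monotoneOn_levelSet_sdiff p (by omega)) x
    rw [hSD.unique hmono (hS.insert_union hmono' hi hS').2]
    exact Finset.mem_insert_self _ _
  · rw [hSD.unique hmono (hS.insert_union hmono' hi hS').2]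
    exact (hS.insert_union hmono' hi hS').1

lemma prod_insert_ite {i : Fin m} {U : Finset (Fin m)} (hi : i ∉ U) (a b : ℝ) :
    ∏ l ∈ insert i U, (if l = i then a else b) = a * b ^ U.card := by
  have h : ∀ l ∈ U, (if l = i then a else b) = b := fun l hl =>
    if_neg (ne_of_mem_of_not_mem hl hi)
  rw [Finset.prod_insert hi, if_pos rfl, Finset.prod_congr rfl h, Finset.prod_const]

end OneVersusRest

/-! ### Step-up procedure in the independent model -/

section Independent

variable {m : ℕ} {E : Type*} [MeasurableSpace E]

lemma measurableSet_levelSet {p : E → ℝ} (hp : Measurable p) (t : ℕ → ℝ) (j : ℕ) :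
    MeasurableSet (levelSet p t j) := measurableSet_le hp measurable_const

lemma measurableSet_forall_mem (S : Finset (Fin m)) {B : Fin m → Set E}
    (hB : ∀ i ∈ S, MeasurableSet (B i)) : MeasurableSet {x : Fin m → E | ∀ i ∈ S, x i ∈ B i} :=
  MeasurableSet.pi (S : Set (Fin m)).to_countable hB

lemma measurableSet_upperCount (S : Finset (Fin m)) {A : ℕ → Set E} (hA : ∀ j, MeasurableSet (A j)) :
    MeasurableSet {x : Fin m → E | UpperCount S A x} := by
  simp_rw [upperCount_iff_lowerCount]
  exact measurableSet_lowerCount _ fun j _ => (hA _).compl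

lemma pi_real_upperCount (ν : Measure E) [IsProbabilityMeasure ν] {t : ℕ → ℝ}
    (ht : IsThreshold m t) {p : E → ℝ} (hp : Measurable p) (S : Finset (Fin m)) :
    (Measure.pi fun _ : Fin m => ν).real
        {x | UpperCount Sᶜ (fun j => levelSet p t (S.card + j)) x} =
      Psi (m - S.card) fun j => 1 - ν.real (levelSet p t (m + 1 - j)) := by
  have hc : Sᶜ.card = m - S.card := by rw [Finset.card_compl, Fintype.card_fin]
  have hle : S.card ≤ m := by simpa using Finset.card_le_univ S
  simp_rw [upperCount_iff_lowerCount, hc]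
  have hmono := ht.monotoneOn_levelSet p
  refine pi_real_lowerCount ν hc (fun i hi j hj hij => ?_)
    (fun j _ => (measurableSet_levelSet hp t _).compl) fun j hj => ?_
  · have := hi.1; have := hi.2; have := hj.1; have := hj.2
    exact Set.compl_subset_compl.2
      (hmono ⟨by omega, by omega⟩ ⟨by omega, by omega⟩ (by omega))
  · have := hj.2
    rw [probReal_compl_eq_one_sub (measurableSet_levelSet hp t _),
      show S.card + (m - S.card + 1 - j) = m + 1 - j by omega]

lemma prod_ite_subset {T S : Finset (Fin m)} (hTS : T ⊆ S) (a b : ℝ) :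
    ∏ i ∈ S, (if i ∈ T then a else b) = a ^ T.card * b ^ (S.card - T.card) := by
  rw [Finset.prod_ite, Finset.prod_const, Finset.prod_const, Finset.filter_mem_eq_inter,
    Finset.inter_eq_right.2 hTS, Finset.filter_notMem_eq_sdiff, Finset.card_sdiff_of_subset hTS]

/-- The joint law of the number of rejections and of the number of marked rejections of a step-up
procedure, for independent and identically distributed observations. -/
theorem integral_SU (ν : Measure E) [IsProbabilityMeasure ν] {t : ℕ → ℝ} (ht : IsThreshold m t)
    {p : E → ℝ} (hp : Measurable p) {M : Set E} (hM : MeasurableSet M) (f : ℕ → ℕ → ℝ) :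
    ∫ x, f (cnt (SU t fun i => p (x i)) M x) (SU t fun i => p (x i)).card
        ∂(Measure.pi fun _ : Fin m => ν) =
      ∑ k ∈ Finset.range (m + 1), (m.choose k : ℝ) * ∑ j ∈ Finset.range (k + 1), (k.choose j : ℝ) *
        (f j k * ((ν.real (levelSet p t k ∩ M)) ^ j * (ν.real (levelSet p t k ∩ Mᶜ)) ^ (k - j) *
          Psi (m - k) fun j => 1 - ν.real (levelSet p t (m + 1 - j)))) := by
  classical
  -- The event `F S T` says that the rejection set is `S` and its marked part is `T`. It constrains
  -- coordinates in `S` and in `Sᶜ` separately, hence the factorisation in `hprob`.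
  let B : Finset (Fin m) → Finset (Fin m) → Fin m → Set E := fun S T i =>
    levelSet p t S.card ∩ if i ∈ T then M else Mᶜ
  let F : Finset (Fin m) → Finset (Fin m) → Set (Fin m → E) := fun S T =>
    {x | ∀ i ∈ S, x i ∈ B S T i} ∩ {x | UpperCount Sᶜ (fun j => levelSet p t (S.card + j)) x}
  have hBm : ∀ S T i, MeasurableSet (B S T i) := fun S T i =>
    (measurableSet_levelSet hp t _).inter (by split_ifs; exacts [hM, hM.compl])
  have hF1 : ∀ S T, MeasurableSet {x : Fin m → E | ∀ i ∈ S, x i ∈ B S T i} := fun S T =>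
    measurableSet_forall_mem S fun i _ => hBm S T i
  have hF2 : ∀ S : Finset (Fin m), MeasurableSet
      {x : Fin m → E | UpperCount Sᶜ (fun j => levelSet p t (S.card + j)) x} := fun S =>
    measurableSet_upperCount _ fun j => measurableSet_levelSet hp t _
  have hF : ∀ S T, T ⊆ S → ∀ x, x ∈ F S T ↔
      SU t (fun i => p (x i)) = S ∧ (S.filter fun i => x i ∈ M) = T := by
    intro S T hTS x
    rw [← isSUSet_iff ht]
    constructor
    · rintro ⟨h1, h2⟩
      refine ⟨⟨fun i hi => (h1 i hi).1, h2⟩, ?_⟩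
      ext i
      rw [Finset.mem_filter]
      constructor
      · rintro ⟨hi, hiM⟩
        by_contra hn
        have := (h1 i hi).2
        rw [if_neg hn] at this
        exact this hiM
      · intro hi
        have := (h1 i (hTS hi)).2
        rw [if_pos hi] at this
        exact ⟨hTS hi, this⟩
    · rintro ⟨⟨h1, h2⟩, rfl⟩
      refine ⟨fun i hi => ⟨h1 i hi, ?_⟩, h2⟩
      by_cases hiM : x i ∈ M <;> simp [hi, hiM]
  have hpt : ∀ x : Fin m → E,
      f (cnt (SU t fun i => p (x i)) M x) (SU t fun i => p (x i)).card =
      ∑ S ∈ (Finset.univ : Finset (Fin m)).powerset, ∑ T ∈ S.powerset,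
        (F S T).indicator (fun _ => f T.card S.card) x := by
    intro x
    rw [Finset.sum_eq_single (SU t fun i => p (x i)),
      Finset.sum_eq_single ((SU t fun i => p (x i)).filter fun i => x i ∈ M)]
    · rw [Set.indicator_of_mem]
      · rfl
      · exact (hF _ _ (Finset.filter_subset _ _) x).2 ⟨rfl, rfl⟩
    · intro T hT hne
      exact Set.indicator_of_notMem (fun h => hne
        ((hF _ _ (Finset.mem_powerset.1 hT) x).1 h).2.symm) _
    · intro h
      exact absurd (Finset.mem_powerset.2 (Finset.filter_subset _ _)) h
    · intro S _ hne
      refine Finset.sum_eq_zero fun T hT => Set.indicator_of_notMem (fun h => hne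
        ((hF _ _ (Finset.mem_powerset.1 hT) x).1 h).1.symm) _
    · intro h
      exact absurd (Finset.mem_powerset.2 (Finset.subset_univ _)) h
  have hFm : ∀ S T, MeasurableSet (F S T) := fun S T => (hF1 S T).inter (hF2 S)
  have hprob : ∀ S T, T ⊆ S → (Measure.pi fun _ : Fin m => ν).real (F S T) =
      (ν.real (levelSet p t S.card ∩ M)) ^ T.card *
        (ν.real (levelSet p t S.card ∩ Mᶜ)) ^ (S.card - T.card) *
        Psi (m - S.card) fun j => 1 - ν.real (levelSet p t (m + 1 - j)) := by
    intro S T hTS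
    have hind := pi_real_inter_of_disjoint ν (disjoint_compl_right (a := S)) (hF1 S T) (hF2 S)
      (fun x y hxy hx i hi => by rw [← hxy i hi]; exact hx i hi)
      (fun x y hxy hx => by
        simp only [Set.mem_ofPred_eq, upperCount_iff_lowerCount] at hx ⊢
        exact (lowerCount_congr _ hxy).1 hx)
    rw [hind, pi_real_forall_mem, pi_real_upperCount ν ht hp, ← prod_ite_subset hTS]
    congr 1
    refine Finset.prod_congr rfl fun i _ => ?_
    by_cases h : i ∈ T <;> simp [B, h]
  simp_rw [hpt]
  have hint : ∀ S T, Integrable ((F S T).indicator fun _ => f T.card S.card)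
      (Measure.pi fun _ : Fin m => ν) := fun S T => (integrable_const _).indicator (hFm S T)
  rw [integral_finsetSum _ fun S _ => integrable_finsetSum _ fun T _ => hint S T]
  have hS : ∀ S ∈ (Finset.univ : Finset (Fin m)).powerset,
      ∫ x, ∑ T ∈ S.powerset, (F S T).indicator (fun _ => f T.card S.card) x
        ∂(Measure.pi fun _ : Fin m => ν) =
      ∑ j ∈ Finset.range (S.card + 1), (S.card.choose j : ℝ) *
        (f j S.card * ((ν.real (levelSet p t S.card ∩ M)) ^ j *
          (ν.real (levelSet p t S.card ∩ Mᶜ)) ^ (S.card - j) *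
          Psi (m - S.card) fun j => 1 - ν.real (levelSet p t (m + 1 - j)))) := by
    intro S _
    rw [integral_finsetSum _ fun T _ => hint S T]
    have := Finset.sum_powerset_apply_card (fun j =>
      (f j S.card * ((ν.real (levelSet p t S.card ∩ M)) ^ j *
          (ν.real (levelSet p t S.card ∩ Mᶜ)) ^ (S.card - j) *
          Psi (m - S.card) fun j => 1 - ν.real (levelSet p t (m + 1 - j))))) (x := S)
    simp_rw [nsmul_eq_mul] at this
    rw [← this]
    refine Finset.sum_congr rfl fun T hT => ?_
    rw [integral_indicator_const _ (hFm S T), hprob S T (Finset.mem_powerset.1 hT), smul_eq_mul,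
      mul_comm]
  rw [Finset.sum_congr rfl hS, Finset.sum_powerset_apply_card (fun k =>
    ∑ j ∈ Finset.range (k + 1), (k.choose j : ℝ) *
        (f j k * ((ν.real (levelSet p t k ∩ M)) ^ j * (ν.real (levelSet p t k ∩ Mᶜ)) ^ (k - j) *
          Psi (m - k) fun j => 1 - ν.real (levelSet p t (m + 1 - j)))))]
  simp_rw [nsmul_eq_mul, Finset.card_univ, Fintype.card_fin]

/-! ### Step-down procedure in the independent model -/

/-- The probability that a marked observation is rejected by a step-down procedure, for independent
and identically distributed observations. -/
theorem integral_indicator_mem_SD (ν : Measure E) [IsProbabilityMeasure ν] {t : ℕ → ℝ} (ht : IsThreshold m t)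
    {p : E → ℝ} (hp : Measurable p) (hp0 : ∀ e, 0 < p e) {M : Set E} (hM : MeasurableSet M)
    (i : Fin m) :
    ∫ x, {x : Fin m → E | x i ∈ M ∧ i ∈ SD t fun i => p (x i)}.indicator (fun _ => (1 : ℝ)) x
        ∂(Measure.pi fun _ : Fin m => ν) =
      ∑ a ∈ Finset.range m, ((m - 1).choose a : ℝ) * (ν.real (levelSet p t (a + 1) ∩ M) *
        (1 - ν.real (levelSet p t (a + 1))) ^ (m - 1 - a) *
          Psi a fun j => ν.real (levelSet p t j)) := by
  classical
  have hmeas := measurableSet_levelSet hp t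
  let T : Finset (Fin m) := Finset.univ.erase i
  have hTcard : T.card = m - 1 := by
    rw [Finset.card_erase_of_mem (Finset.mem_univ i), Finset.card_univ, Fintype.card_fin]
  have hmonoT : MonotoneOn (levelSet p t) (Set.Icc 1 T.card) :=
    ht.monotoneOn_levelSet_of_card_le p (by omega)
  -- The event `F S` says that the others reject `S` on their own and that `i` is marked and passes
  -- at level `#S + 1`. The conditions bear on the disjoint blocks `i`, `T \ S` and `S`.
  let B : Finset (Fin m) → Fin m → Set E := fun S l =>
    if l = i then levelSet p t (S.card + 1) ∩ M else (levelSet p t (S.card + 1))ᶜ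
  let F : Finset (Fin m) → Set (Fin m → E) := fun S =>
    {x | ∀ l ∈ insert i (T \ S), x l ∈ B S l} ∩ {x | LowerCount S (levelSet p t) x}
  have hBm : ∀ S l, MeasurableSet (B S l) := fun S l => by
    by_cases h : l = i
    · simpa [B, h] using (hmeas _).inter hM
    · simpa [B, h] using (hmeas _).compl
  have hF1 : ∀ S, MeasurableSet {x : Fin m → E | ∀ l ∈ insert i (T \ S), x l ∈ B S l} := fun S =>
    measurableSet_forall_mem _ fun l _ => hBm S l
  have hF2 : ∀ S : Finset (Fin m), MeasurableSet
      {x : Fin m → E | LowerCount S (levelSet p t) x} := fun S =>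
    measurableSet_lowerCount _ fun j _ => hmeas _
  have hFm : ∀ S, MeasurableSet (F S) := fun S => (hF1 S).inter (hF2 S)
  have hF : ∀ S ⊆ T, ∀ x, x ∈ F S ↔
      IsSDSet T (levelSet p t) x S ∧ x i ∈ levelSet p t (S.card + 1) ∧ x i ∈ M := by
    intro S hST x
    have hne : ∀ l ∈ T \ S, l ≠ i := fun l hl =>
      Finset.ne_of_mem_erase (Finset.mem_sdiff.1 hl).1
    constructor
    · rintro ⟨h1, h2⟩
      refine ⟨⟨hST, h2, fun l hl => ?_⟩, ?_⟩
      · simpa [B, hne l hl] using h1 l (Finset.mem_insert_of_mem hl)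
      · simpa [B] using h1 i (Finset.mem_insert_self _ _)
    · rintro ⟨⟨-, h2, h3⟩, h4⟩
      refine ⟨fun l hl => ?_, h2⟩
      rcases Finset.mem_insert.1 hl with rfl | hl
      · simpa [B] using h4
      · simpa [B, hne l hl] using h3 l hl
  have hpt : ∀ x : Fin m → E,
      {x : Fin m → E | x i ∈ M ∧ i ∈ SD t fun i => p (x i)}.indicator (fun _ => (1 : ℝ)) x =
      ∑ S ∈ T.powerset, (F S).indicator (fun _ => (1 : ℝ)) x := by
    intro x
    obtain ⟨S, hS⟩ := exists_isSDSet hmonoT x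
    rw [Finset.sum_eq_single S]
    · refine Set.indicator_const_eq_indicator_const ?_
      rw [hF S hS.1, Set.mem_ofPred_eq, (SD_eq_of_isSDSet ht hp0 hS).1]
      tauto
    · intro S' hS' hne
      refine Set.indicator_of_notMem (fun h => hne ?_) _
      exact ((hF S' (Finset.mem_powerset.1 hS') x).1 h).1.unique hmonoT hS
    · intro h
      exact absurd (Finset.mem_powerset.2 hS.1) h
  have hprob : ∀ S ⊆ T, (Measure.pi fun _ : Fin m => ν).real (F S) =
      ν.real (levelSet p t (S.card + 1) ∩ M) *
        (1 - ν.real (levelSet p t (S.card + 1))) ^ (m - 1 - S.card) *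
          Psi S.card fun j => ν.real (levelSet p t j) := by
    intro S hST
    have hiS : i ∉ S := fun h => by simpa [T] using hST h
    have hdisj : Disjoint (insert i (T \ S)) S := by
      rw [Finset.disjoint_insert_left]
      exact ⟨hiS, Finset.sdiff_disjoint⟩
    have hle := card_add_one_le hST
    rw [pi_real_inter_of_disjoint ν hdisj (hF1 S) (hF2 S)
      (fun x y hxy hx l hl => by rw [← hxy l hl]; exact hx l hl)
      (fun x y hxy hx => (lowerCount_congr _ hxy).1 hx), pi_real_forall_mem,
      pi_real_lowerCount ν rfl (ht.monotoneOn_levelSet_of_card_le p (by omega))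
        (fun j _ => hmeas j) fun _ _ => rfl,
      ← card_univ_erase_sdiff hST, ← prod_insert_ite (i := i) (by simp)]
    congr 1
    refine Finset.prod_congr rfl fun l _ => ?_
    by_cases h : l = i
    · simp [B, h]
    · simp [B, h, probReal_compl_eq_one_sub (hmeas _)]
  simp_rw [hpt]
  rw [integral_finsetSum _ fun S _ => (integrable_const _).indicator (hFm S)]
  have := Finset.sum_powerset_apply_card (fun a => ν.real (levelSet p t (a + 1) ∩ M) *
        (1 - ν.real (levelSet p t (a + 1))) ^ (m - 1 - a) *
          Psi a fun j => ν.real (levelSet p t j)) (x := T)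
  simp_rw [nsmul_eq_mul, hTcard, Nat.sub_add_cancel i.pos] at this
  rw [← this]
  refine Finset.sum_congr rfl fun S hS => ?_
  rw [integral_indicator_const _ (hFm S), hprob S (Finset.mem_powerset.1 hS), smul_eq_mul, mul_one]

/-- The expectation of a function of the number of rejections of a step-down procedure, on the event
that a marked observation is rejected. -/
theorem integral_SD (ν : Measure E) [IsProbabilityMeasure ν] {t : ℕ → ℝ} (ht : IsThreshold m t)
    {p : E → ℝ} (hp : Measurable p) (hp0 : ∀ e, 0 < p e) {M : Set E} (hM : MeasurableSet M)
    (i : Fin m) (g : ℕ → ℝ) :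
    ∫ x, {x : Fin m → E | x i ∈ M ∧ i ∈ SD t fun i => p (x i)}.indicator
        (fun x => g (SD t fun i => p (x i)).card) x ∂(Measure.pi fun _ : Fin m => ν) =
      ∑ a ∈ Finset.range m, ((m - 1).choose a : ℝ) * ∑ b ∈ Finset.range (m - a),
        ((m - 1 - a).choose b : ℝ) * (g (a + 1 + b) * (ν.real (levelSet p t (a + 1) ∩ M) *
          (1 - ν.real (levelSet p t (a + 1 + b + 1))) ^ (m - 1 - a - b) *
          (Psi a fun j => ν.real (levelSet p t j)) *
          ((1 - ν.real (levelSet p t (a + 1))) ^ b *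
            Psi b fun j => (ν.real (levelSet p t (a + 1 + j)) - ν.real (levelSet p t (a + 1))) /
              (1 - ν.real (levelSet p t (a + 1)))))) := by
  classical
  have hmeas := measurableSet_levelSet hp t
  let T : Finset (Fin m) := Finset.univ.erase i
  have hTcard : T.card = m - 1 := by
    rw [Finset.card_erase_of_mem (Finset.mem_univ i), Finset.card_univ, Fintype.card_fin]
  have hmonoT : MonotoneOn (levelSet p t) (Set.Icc 1 T.card) :=
    ht.monotoneOn_levelSet_of_card_le p (by omega)
  let A' : ℕ → ℕ → Set E := fun k j => levelSet p t (k + j) \ levelSet p t k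
  have hmeas' : ∀ k j, MeasurableSet (A' k j) := fun k j => MeasurableSet.diff (hmeas _) (hmeas _)
  have hmonoA' : ∀ S ⊆ T, MonotoneOn (A' (S.card + 1)) (Set.Icc 1 (T \ S).card) := fun S hS => by
    have h1 := card_univ_erase_sdiff hS
    have h2 := card_add_one_le hS
    exact ht.monotoneOn_levelSet_sdiff p (by change _ + (Finset.univ.erase i \ S).card ≤ _; omega)
  -- Here `S` is the first pass among the others and `S'` the second pass, after `i` has joined.
  -- Never-rejected indices must avoid the stopping levels of both passes.
  let B : Finset (Fin m) → Finset (Fin m) → Fin m → Set E := fun S S' l =>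
    if l = i then levelSet p t (S.card + 1) ∩ M
    else (levelSet p t (S.card + 1))ᶜ ∩ (A' (S.card + 1) (S'.card + 1))ᶜ
  let F₀ : Finset (Fin m) → Finset (Fin m) → Set (Fin m → E) := fun S S' =>
    {x | ∀ l ∈ insert i ((T \ S) \ S'), x l ∈ B S S' l} ∩ {x | LowerCount S (levelSet p t) x}
  let F : Finset (Fin m) → Finset (Fin m) → Set (Fin m → E) := fun S S' =>
    F₀ S S' ∩ {x | LowerCount S' (A' (S.card + 1)) x}
  have hBm : ∀ S S' l, MeasurableSet (B S S' l) := fun S S' l => by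
    by_cases h : l = i
    · simpa [B, h] using (hmeas _).inter hM
    · simpa only [B, h, if_false] using (hmeas _).compl.inter (hmeas' _ _).compl
  have hF1 : ∀ S S', MeasurableSet {x : Fin m → E | ∀ l ∈ insert i ((T \ S) \ S'), x l ∈ B S S' l} :=
    fun S S' => measurableSet_forall_mem _ fun l _ => hBm S S' l
  have hF2 : ∀ S : Finset (Fin m), MeasurableSet
      {x : Fin m → E | LowerCount S (levelSet p t) x} := fun S =>
    measurableSet_lowerCount _ fun j _ => hmeas _
  have hF3 : ∀ (S' : Finset (Fin m)) k, MeasurableSet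
      {x : Fin m → E | LowerCount S' (A' k) x} := fun S' k =>
    measurableSet_lowerCount _ fun j _ => hmeas' _ _
  have hF₀m : ∀ S S', MeasurableSet (F₀ S S') := fun S S' => (hF1 S S').inter (hF2 S)
  have hFm : ∀ S S', MeasurableSet (F S S') := fun S S' => (hF₀m S S').inter (hF3 S' _)
  have hF : ∀ S ⊆ T, ∀ S' ⊆ T \ S, ∀ x, x ∈ F S S' ↔
      IsSDSet T (levelSet p t) x S ∧ (x i ∈ levelSet p t (S.card + 1) ∧ x i ∈ M) ∧
        IsSDSet (T \ S) (A' (S.card + 1)) x S' := by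
    intro S hST S' hS' x
    have hne : ∀ l ∈ T \ S, l ≠ i := fun l hl =>
      Finset.ne_of_mem_erase (Finset.mem_sdiff.1 hl).1
    constructor
    · rintro ⟨⟨h1, h2⟩, h3⟩
      have h1' : ∀ l ∈ (T \ S) \ S', x l ∉ levelSet p t (S.card + 1) ∧
          x l ∉ A' (S.card + 1) (S'.card + 1) := fun l hl => by
        have := h1 l (Finset.mem_insert_of_mem hl)
        simp only [B, hne l (Finset.mem_sdiff.1 hl).1, if_false] at this
        exact this
      refine ⟨⟨hST, h2, fun l hl => ?_⟩, ?_, hS', h3, fun l hl => (h1' l hl).2⟩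
      -- Points rejected in the second pass lie above the first stopping level automatically, as the
      -- levels `A'` exclude it; hence `F` need not require it.
      · by_cases hl' : l ∈ S'
        · exact (h3.mem hl').2
        · exact (h1' l (Finset.mem_sdiff.2 ⟨hl, hl'⟩)).1
      · simpa [B] using h1 i (Finset.mem_insert_self _ _)
    · rintro ⟨⟨-, h2, h3⟩, h4, -, h5, h6⟩
      refine ⟨⟨fun l hl => ?_, h2⟩, h5⟩
      rcases Finset.mem_insert.1 hl with rfl | hl
      · simpa [B] using h4
      · have hl' := (Finset.mem_sdiff.1 hl).1
        simp only [B, hne l hl', if_false]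
        exact ⟨h3 l hl', h6 l hl⟩
  have hpt : ∀ x : Fin m → E,
      {x : Fin m → E | x i ∈ M ∧ i ∈ SD t fun i => p (x i)}.indicator
        (fun x => g (SD t fun i => p (x i)).card) x =
      ∑ S ∈ T.powerset, ∑ S' ∈ (T \ S).powerset,
        (F S S').indicator (fun _ => g (S.card + 1 + S'.card)) x := by
    intro x
    obtain ⟨S, hS⟩ := exists_isSDSet hmonoT x
    obtain ⟨S', hS'⟩ := exists_isSDSet (hmonoA' S hS.1) x
    rw [Finset.sum_eq_single S, Finset.sum_eq_single S']
    · have hiff := (SD_eq_of_isSDSet ht hp0 hS).1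
      by_cases hx : x i ∈ M ∧ i ∈ SD t fun i => p (x i)
      · rw [Set.indicator_of_mem (s := {x : Fin m → E | x i ∈ M ∧ i ∈ SD t fun i => p (x i)}) hx,
          Set.indicator_of_mem ((hF S hS.1 S' hS'.1 x).2 ⟨hS, ⟨hiff.1 hx.2, hx.1⟩, hS'⟩),
          (SD_eq_of_isSDSet ht hp0 hS).2 S' (hiff.1 hx.2) hS']
      · rw [Set.indicator_of_notMem (s := {x : Fin m → E | x i ∈ M ∧ i ∈ SD t fun i => p (x i)}) hx,
          Set.indicator_of_notMem]
        intro h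
        have := ((hF S hS.1 S' hS'.1 x).1 h).2.1
        exact hx ⟨this.2, hiff.2 this.1⟩
    · intro S'' hS'' hne
      refine Set.indicator_of_notMem (fun h => hne ?_) _
      exact ((hF S hS.1 S'' (Finset.mem_powerset.1 hS'') x).1 h).2.2.unique (hmonoA' S hS.1) hS'
    · intro h
      exact absurd (Finset.mem_powerset.2 hS'.1) h
    · intro S₂ hS₂ hne
      refine Finset.sum_eq_zero fun S₂' hS₂' => Set.indicator_of_notMem (fun h => hne ?_) _
      exact ((hF S₂ (Finset.mem_powerset.1 hS₂) S₂' (Finset.mem_powerset.1 hS₂') x).1 h).1.unique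
        hmonoT hS
    · intro h
      exact absurd (Finset.mem_powerset.2 hS.1) h
  have hprob : ∀ S ⊆ T, ∀ S' ⊆ T \ S, (Measure.pi fun _ : Fin m => ν).real (F S S') =
      ν.real (levelSet p t (S.card + 1) ∩ M) *
        (1 - ν.real (levelSet p t (S.card + 1 + S'.card + 1))) ^ (m - 1 - S.card - S'.card) *
          (Psi S.card fun j => ν.real (levelSet p t j)) *
          ((1 - ν.real (levelSet p t (S.card + 1))) ^ S'.card *
            Psi S'.card fun j =>
              (ν.real (levelSet p t (S.card + 1 + j)) - ν.real (levelSet p t (S.card + 1))) /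
                (1 - ν.real (levelSet p t (S.card + 1)))) := by
    intro S hST S' hS'
    have hiS : i ∉ S := fun h => by simpa [T] using hST h
    have hiS' : i ∉ S' := fun h => by simpa [T] using hS' h
    have hdisj : Disjoint (insert i ((T \ S) \ S')) S := by
      rw [Finset.disjoint_insert_left]
      exact ⟨hiS, Finset.disjoint_of_subset_left Finset.sdiff_subset Finset.sdiff_disjoint⟩
    have hdisj' : Disjoint (insert i ((T \ S) \ S') ∪ S) S' := by
      rw [Finset.disjoint_union_left, Finset.disjoint_insert_left]
      exact ⟨⟨hiS', Finset.sdiff_disjoint⟩,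
        Finset.disjoint_of_subset_right hS' Finset.disjoint_sdiff⟩
    have hle := card_add_one_le hST
    have hTS : (T \ S).card = m - 1 - S.card := card_univ_erase_sdiff hST
    have hS'le := Finset.card_le_card hS'
    have hrest : ((T \ S) \ S').card = m - 1 - S.card - S'.card := by
      rw [Finset.card_sdiff_of_subset hS', hTS]
    have hsub : ∀ j, S.card + 1 + j ≤ m →
        levelSet p t (S.card + 1) ⊆ levelSet p t (S.card + 1 + j) := fun j hj =>
      ht.monotoneOn_levelSet p ⟨by omega, by omega⟩ ⟨by omega, hj⟩ (Nat.le_add_right _ _)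
    have hLC : (Measure.pi fun _ : Fin m => ν).real {x | LowerCount S' (A' (S.card + 1)) x} =
        (1 - ν.real (levelSet p t (S.card + 1))) ^ S'.card *
            Psi S'.card fun j =>
              (ν.real (levelSet p t (S.card + 1 + j)) - ν.real (levelSet p t (S.card + 1))) /
                (1 - ν.real (levelSet p t (S.card + 1))) := by
      rw [pi_real_lowerCount_of_subset ν rfl
        ((hmonoA' S hST).mono (Set.Icc_subset_Icc_right hS'le))
        (fun j _ => hmeas' _ j) (hmeas (S.card + 1)).compl fun j _ => Set.sdiff_subset_compl _ _,
        probReal_compl_eq_one_sub (hmeas _)]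
      congr 1
      refine Psi_congr fun j hj => ?_
      have := hj.2
      rw [measureReal_sdiff (hsub j (by omega)) (hmeas _)]
    rw [pi_real_inter_of_disjoint ν hdisj' (hF₀m S S') (hF3 S' _)
      (fun x y hxy hx => ⟨fun l hl => by
          rw [← hxy l (Finset.mem_union_left _ hl)]; exact hx.1 l hl,
        (lowerCount_congr _ fun l hl => hxy l (Finset.mem_union_right _ hl)).1 hx.2⟩)
      (fun x y hxy hx => (lowerCount_congr _ hxy).1 hx), hLC,
      pi_real_inter_of_disjoint ν hdisj (hF1 S S') (hF2 S)
      (fun x y hxy hx l hl => by rw [← hxy l hl]; exact hx l hl)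
      (fun x y hxy hx => (lowerCount_congr _ hxy).1 hx), pi_real_forall_mem,
      pi_real_lowerCount ν rfl (ht.monotoneOn_levelSet_of_card_le p (by omega))
        (fun j _ => hmeas j) fun _ _ => rfl,
      ← hrest, ← prod_insert_ite (i := i) (by simp [T])]
    congr 2
    refine Finset.prod_congr rfl fun l hl => ?_
    by_cases h : l = i
    · simp [B, h]
    · have hl' : l ∈ (T \ S) \ S' := (Finset.mem_insert.1 hl).resolve_left h
      -- A leftover index guarantees `#S + #S' + 2 ≤ m`, so the level used is a genuine threshold.
      -- Beyond `m`, where `t` is arbitrary, the corresponding exponent is `0`.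
      have hpos := Finset.card_pos.2 ⟨l, hl'⟩
      have hunion : (levelSet p t (S.card + 1))ᶜ ∩ (A' (S.card + 1) (S'.card + 1))ᶜ =
          (levelSet p t (S.card + 1 + S'.card + 1))ᶜ := by
        rw [← Set.compl_union, Set.union_sdiff_cancel (hsub _ (by omega))]
        rfl
      simp only [B, h, if_false]
      rw [hunion, probReal_compl_eq_one_sub (hmeas _)]
  simp_rw [hpt]
  have hint : ∀ S S', Integrable ((F S S').indicator fun _ => g (S.card + 1 + S'.card))
      (Measure.pi fun _ : Fin m => ν) := fun S S' => (integrable_const _).indicator (hFm S S')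
  rw [integral_finsetSum _ fun S _ => integrable_finsetSum _ fun S' _ => hint S S']
  let h : ℕ → ℕ → ℝ := fun a b => g (a + 1 + b) * (ν.real (levelSet p t (a + 1) ∩ M) *
          (1 - ν.real (levelSet p t (a + 1 + b + 1))) ^ (m - 1 - a - b) *
          (Psi a fun j => ν.real (levelSet p t j)) *
          ((1 - ν.real (levelSet p t (a + 1))) ^ b *
            Psi b fun j => (ν.real (levelSet p t (a + 1 + j)) - ν.real (levelSet p t (a + 1))) /
              (1 - ν.real (levelSet p t (a + 1)))))
  have hS : ∀ S ∈ T.powerset, ∫ x, ∑ S' ∈ (T \ S).powerset,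
        (F S S').indicator (fun _ => g (S.card + 1 + S'.card)) x ∂(Measure.pi fun _ : Fin m => ν) =
      ∑ b ∈ Finset.range (m - S.card), ((m - 1 - S.card).choose b : ℝ) * h S.card b := by
    intro S hS
    have hST := Finset.mem_powerset.1 hS
    have hle := card_add_one_le hST
    rw [integral_finsetSum _ fun S' _ => hint S S']
    have := Finset.sum_powerset_apply_card (h S.card) (x := T \ S)
    rw [show (T \ S).card = m - 1 - S.card from card_univ_erase_sdiff hST,
      show m - 1 - S.card + 1 = m - S.card by omega] at this
    simp_rw [nsmul_eq_mul] at this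
    rw [← this]
    refine Finset.sum_congr rfl fun S' hS' => ?_
    rw [integral_indicator_const _ (hFm S S'), hprob S hST S' (Finset.mem_powerset.1 hS'),
      smul_eq_mul, mul_comm]
  rw [Finset.sum_congr rfl hS, Finset.sum_powerset_apply_card (fun a =>
    ∑ b ∈ Finset.range (m - a), ((m - 1 - a).choose b : ℝ) * h a b)]
  simp_rw [nsmul_eq_mul, hTcard, Nat.sub_add_cancel i.pos]
  rfl

end Independent

/-! ### Binomial moments and Stirling numbers -/

/-- Induction on `s`: multiplying the falling factorial of order `l` by `j` gives the one of order
`l + 1` plus `l` times itself, which matches the Stirling recurrence. -/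
lemma pow_eq_sum_stirlingSecond (s j : ℕ) :
    (j : ℝ) ^ s =
      ∑ l ∈ Finset.range (s + 1), (Nat.stirlingSecond s l : ℝ) * (j.descFactorial l : ℝ) := by
  induction s with
  | zero => simp
  | succ s ih =>
    have hstep : ∀ l, (j.descFactorial l : ℝ) * j =
        j.descFactorial (l + 1) + l * j.descFactorial l := fun l => by
      rcases le_or_gt l j with h | h
      · rw [Nat.descFactorial_succ]
        push_cast [Nat.cast_sub h]
        ring
      · rw [Nat.descFactorial_eq_zero_iff_lt.2 h,
          Nat.descFactorial_eq_zero_iff_lt.2 (h.trans (Nat.lt_succ_self l))]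
        simp
    have hshift : ∑ l ∈ Finset.range (s + 1),
          ((l + 1 : ℕ) : ℝ) * Nat.stirlingSecond s (l + 1) * j.descFactorial (l + 1) =
        ∑ l ∈ Finset.range (s + 1), (l : ℝ) * Nat.stirlingSecond s l * j.descFactorial l := by
      rw [Finset.sum_range_succ, Finset.sum_range_succ' _ s,
        Nat.stirlingSecond_eq_zero_of_lt (Nat.lt_succ_self s)]
      simp
    rw [pow_succ, ih, Finset.sum_mul, Finset.sum_range_succ' _ (s + 1), Nat.stirlingSecond_succ_zero,
      Nat.cast_zero, zero_mul, add_zero]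
    simp_rw [Nat.stirlingSecond_succ_succ, mul_assoc, hstep]
    push_cast at hshift ⊢
    simp_rw [add_mul, mul_add, Finset.sum_add_distrib] at hshift ⊢
    rw [add_comm, hshift]
    congr 1
    exact Finset.sum_congr rfl fun l _ => by ring

/-- Factorial moments of an unnormalised binomial law: choosing `j` of `k` and then an ordered
`l`-tuple among them amounts to choosing the tuple first, and the binomial theorem sums over the
rest. -/
lemma sum_choose_descFactorial (k l : ℕ) (a b : ℝ) :
    ∑ j ∈ Finset.range (k + 1), (k.choose j : ℝ) * (j.descFactorial l * (a ^ j * b ^ (k - j))) =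
      k.descFactorial l * (a ^ l * (a + b) ^ (k - l)) := by
  rcases lt_or_ge k l with h | h
  · rw [Nat.descFactorial_eq_zero_iff_lt.2 h, Nat.cast_zero, zero_mul]
    refine Finset.sum_eq_zero fun j hj => ?_
    rw [Nat.descFactorial_eq_zero_iff_lt.2 ((Finset.mem_range_succ_iff.1 hj).trans_lt h)]
    simp
  · rw [show k + 1 = l + (k - l + 1) by omega, Finset.sum_range_add, Finset.sum_eq_zero, zero_add,
      add_pow, Finset.mul_sum, Finset.mul_sum]
    · refine Finset.sum_congr rfl fun i hi => ?_
      have hi' : i ≤ k - l := Finset.mem_range_succ_iff.1 hi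
      have h1 : (k.choose (l + i) : ℝ) * (l + i).descFactorial l =
          k.descFactorial l * (k - l).choose i := by
        have := Nat.choose_mul (n := k) (k := l + i) (s := l) (Nat.le_add_right _ _)
        rw [Nat.add_sub_cancel_left] at this
        rw [Nat.descFactorial_eq_factorial_mul_choose, Nat.descFactorial_eq_factorial_mul_choose]
        have h2 : (k.choose (l + i) : ℝ) * (l + i).choose l = k.choose l * (k - l).choose i := by
          exact_mod_cast this
        push_cast
        linear_combination (l.factorial : ℝ) * h2
      rw [← mul_assoc, h1, show k - (l + i) = k - l - i by omega, pow_add]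
      ring
    · intro j hj
      rw [Nat.descFactorial_eq_zero_iff_lt.2 (Finset.mem_range.1 hj)]
      simp

/-- Weighted mixed binomial moments expressed through Stirling numbers. -/
lemma sum_choose_moment (m : ℕ) {s : ℕ} (hs : 1 ≤ s) (a b w P : ℕ → ℝ) :
    ∑ k ∈ Finset.range (m + 1), (m.choose k : ℝ) * ∑ j ∈ Finset.range (k + 1), (k.choose j : ℝ) *
        ((j : ℝ) ^ s * w k * (a k ^ j * b k ^ (k - j) * P k)) =
      ∑ l ∈ Finset.Icc 1 (min s m), (m.factorial : ℝ) / ((m - l).factorial : ℝ) *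
        (Nat.stirlingSecond s l : ℝ) * ∑ k ∈ Finset.Icc l m, a k ^ l * w k *
          (((m - l).choose (k - l) : ℝ) * (a k + b k) ^ (k - l) * P k) := by
  let T : ℕ → ℕ → ℝ := fun k l => (m.choose k : ℝ) * (Nat.stirlingSecond s l *
    (k.descFactorial l * (a k ^ l * (a k + b k) ^ (k - l)))) * w k * P k
  have hL : ∀ k, (m.choose k : ℝ) * ∑ j ∈ Finset.range (k + 1), (k.choose j : ℝ) *
        ((j : ℝ) ^ s * w k * (a k ^ j * b k ^ (k - j) * P k)) =
      ∑ l ∈ Finset.range (s + 1), T k l := by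
    intro k
    simp_rw [T, ← sum_choose_descFactorial k _ (a k) (b k), pow_eq_sum_stirlingSecond s,
      Finset.mul_sum, Finset.sum_mul, Finset.mul_sum]
    rw [Finset.sum_comm]
    exact Finset.sum_congr rfl fun l _ => Finset.sum_congr rfl fun j _ => by ring
  simp_rw [hL]
  rw [Finset.sum_comm]
  have hsub : Finset.Icc 1 (min s m) ⊆ Finset.range (s + 1) := fun l hl => by
    rw [Finset.mem_Icc] at hl
    rw [Finset.mem_range]
    omega
  rw [← Finset.sum_subset hsub]
  · refine Finset.sum_congr rfl fun l hl => ?_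
    rw [Finset.mem_Icc] at hl
    have hlm : l ≤ m := by omega
    have hsub' : Finset.Icc l m ⊆ Finset.range (m + 1) := fun k hk => by
      rw [Finset.mem_Icc] at hk
      rw [Finset.mem_range]
      omega
    rw [← Finset.sum_subset hsub', Finset.mul_sum]
    · refine Finset.sum_congr rfl fun k hk => ?_
      rw [Finset.mem_Icc] at hk
      -- The same subset-of-subset exchange, one layer up: the `l` marked rejections are chosen
      -- first among all `m` indices.
      have h1 : (m.choose k : ℝ) * k.descFactorial l =
          (m.factorial : ℝ) / ((m - l).factorial : ℝ) * (m - l).choose (k - l) := by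
        have h2 : (m.choose k : ℝ) * k.choose l = m.choose l * (m - l).choose (k - l) := by
          exact_mod_cast Nat.choose_mul (n := m) hk.1
        rw [Nat.descFactorial_eq_factorial_mul_choose, Nat.cast_mul,
          show (m.factorial : ℝ) / (m - l).factorial = l.factorial * m.choose l by
            rw [div_eq_iff (by positivity)]
            have := Nat.choose_mul_factorial_mul_factorial hlm
            rw [← this]
            push_cast
            ring]
        linear_combination (l.factorial : ℝ) * h2
      simp only [T]
      linear_combination (Nat.stirlingSecond s l * (a k ^ l * (a k + b k) ^ (k - l)) * w k * P k) * h1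
    · intro k hk hk'
      have : k < l := by
        rw [Finset.mem_range] at hk
        rw [Finset.mem_Icc] at hk'
        omega
      simp [T, Nat.descFactorial_eq_zero_iff_lt.2 this]
  · intro l hl hl'
    refine Finset.sum_eq_zero fun k hk => ?_
    rw [Finset.mem_range] at hk hl
    rw [Finset.mem_Icc] at hl'
    -- The term `l = 0` disappears because `s ≥ 1` makes its Stirling number zero.
    rcases Nat.eq_zero_or_pos l with rfl | hpos
    · obtain ⟨s', rfl⟩ := Nat.exists_eq_succ_of_ne_zero (Nat.one_le_iff_ne_zero.1 hs)
      simp [T]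
    · have : k < l := by omega
      simp [T, Nat.descFactorial_eq_zero_iff_lt.2 this]

lemma sum_Icc_one_eq_sum_range (m : ℕ) (f : ℕ → ℝ) :
    ∑ k ∈ Finset.Icc 1 m, f k = ∑ a ∈ Finset.range m, f (a + 1) := by
  have : Finset.Icc 1 m = Finset.Ico 1 (m + 1) := rfl
  rw [this, Finset.sum_Ico_eq_sum_range]
  simp [add_comm]

lemma sum_Icc_eq_sum_range (k m : ℕ) (f : ℕ → ℝ) :
    ∑ k' ∈ Finset.Icc k m, f k' = ∑ b ∈ Finset.range (m + 1 - k), f (k + b) := by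
  have : Finset.Icc k m = Finset.Ico k (m + 1) := rfl
  rw [this, Finset.sum_Ico_eq_sum_range]

/-! ### Measurability of stepwise procedures -/

section Measurability

variable {m : ℕ}

lemma measurableSet_orderStat_le (k : ℕ) (s : ℝ) :
    MeasurableSet {p : Fin m → ℝ | orderStat p k ≤ s} := by
  by_cases hk : k ∈ Set.Icc 1 m
  · simp_rw [orderStat_le_iff _ hk]
    exact measurableSet_le measurable_const (measurable_cnt _ measurableSet_Iic)
  · have : ∀ p : Fin m → ℝ, orderStat p k = 0 := fun p => dif_neg hk
    simp_rw [this]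
    exact MeasurableSet.const _

lemma measurable_stepUpIndex (t : ℕ → ℝ) : Measurable (stepUpIndex (m := m) t) := by
  classical
  exact measurable_findGreatest fun k _ => measurableSet_orderStat_le k _

lemma measurable_stepDownIndex (t : ℕ → ℝ) : Measurable (stepDownIndex (m := m) t) := by
  classical
  refine measurable_findGreatest fun k _ => ?_
  have : {p : Fin m → ℝ | ∀ k' ≤ k, orderStat p k' ≤ t k'} =
      ⋂ k' ∈ Set.Iic k, {p | orderStat p k' ≤ t k'} := by
    ext p; simp
  rw [this]
  exact MeasurableSet.biInter (Set.to_countable _) fun k' _ => measurableSet_orderStat_le k' _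

lemma measurableSet_mem_SU (t : ℕ → ℝ) (i : Fin m) :
    MeasurableSet {p : Fin m → ℝ | i ∈ SU t p} := by
  simp_rw [mem_SU]
  exact measurableSet_le (measurable_pi_apply i)
    ((measurable_of_countable t).comp (measurable_stepUpIndex t))

lemma measurableSet_mem_SD (t : ℕ → ℝ) (i : Fin m) :
    MeasurableSet {p : Fin m → ℝ | i ∈ SD t p} := by
  simp_rw [mem_SD]
  exact measurableSet_le (measurable_pi_apply i)
    ((measurable_of_countable t).comp (measurable_stepDownIndex t))

variable {Ω : Type*} [MeasurableSpace Ω]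

lemma measurable_card_of_mem {R : Ω → Finset (Fin m)}
    (hR : ∀ i, MeasurableSet {ω | i ∈ R ω}) : Measurable fun ω => (R ω).card := by
  classical
  have : (fun ω => (R ω).card) = fun ω => ∑ i, if i ∈ R ω then 1 else 0 := by
    funext ω; simp
  rw [this]
  exact Finset.measurable_sum _ fun i _ =>
    Measurable.ite (hR i) measurable_const measurable_const

lemma measurable_FDP {R : (Fin m → ℝ) → Finset (Fin m)}
    (hR : ∀ i, MeasurableSet {p | i ∈ R p}) :
    Measurable fun z : (Fin m → Bool) × (Fin m → ℝ) => FDP (R z.2) z.1 := by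
  have h1 : Measurable fun z : (Fin m → Bool) × (Fin m → ℝ) => (trueNulls z.1 ∩ R z.2).card := by
    refine measurable_card_of_mem fun i => ?_
    simp only [Finset.mem_inter, trueNulls, Finset.mem_filter, Finset.mem_univ, true_and]
    exact (measurableSet_eq_fun (by fun_prop) measurable_const).inter (measurable_snd (hR i))
  have h2 : Measurable fun z : (Fin m → Bool) × (Fin m → ℝ) => (R z.2).card :=
    (measurable_card_of_mem hR).comp measurable_snd
  exact ((measurable_of_countable fun n : ℕ => (n : ℝ)).comp h1).div
    ((measurable_of_countable fun n : ℕ => ((max n 1 : ℕ) : ℝ)).comp h2)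

lemma measurable_card_falseNulls_inter {R : (Fin m → ℝ) → Finset (Fin m)}
    (hR : ∀ i, MeasurableSet {p | i ∈ R p}) :
    Measurable fun z : (Fin m → Bool) × (Fin m → ℝ) => ((falseNulls z.1 ∩ R z.2).card : ℝ) := by
  refine (measurable_of_countable fun n : ℕ => (n : ℝ)).comp (measurable_card_of_mem fun i => ?_)
  simp only [Finset.mem_inter, falseNulls, Finset.mem_filter, Finset.mem_univ, true_and]
  exact (measurableSet_eq_fun (by fun_prop) measurable_const).inter (measurable_snd (hR i))

lemma FDP_mem_Icc (R : Finset (Fin m)) (H : Fin m → Bool) : FDP R H ∈ Set.Icc (0 : ℝ) 1 := by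
  refine ⟨by unfold FDP; positivity, ?_⟩
  rw [FDP, div_le_one (by positivity)]
  exact_mod_cast (Finset.card_le_card Finset.inter_subset_right).trans (le_max_left _ _)

end Measurability

/-! ### The formulas of the independent model -/

section IndependentFormulas

variable {m : ℕ} {E : Type*}

lemma card_trueNulls_inter (η : E → Bool) (x : Fin m → E) (R : Finset (Fin m)) :
    (trueNulls (fun i => η (x i)) ∩ R).card = cnt R {e | η e = false} x := by
  classical
  rw [cnt]
  congr 1
  ext i
  simp [trueNulls, and_comm]

lemma card_falseNulls_inter (η : E → Bool) (x : Fin m → E) (R : Finset (Fin m)) :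
    (falseNulls (fun i => η (x i)) ∩ R).card = cnt R {e | η e = true} x := by
  classical
  rw [cnt]
  congr 1
  ext i
  simp [falseNulls, and_comm]

lemma compl_mark_false (η : E → Bool) : {e | η e = false}ᶜ = {e | η e = true} := by
  ext e; simp

lemma compl_mark_true (η : E → Bool) : {e | η e = true}ᶜ = {e | η e = false} := by
  ext e; simp

/-- This linearises the FDP and the power into single-index events; the constant `c` will be the
inverse number of rejections, or `1`. -/
lemma cnt_eq_sum_indicator (R : Finset (Fin m)) (M : Set E) (x : Fin m → E) (c : ℝ) :
    (cnt R M x : ℝ) * c =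
      ∑ i, {x : Fin m → E | x i ∈ M ∧ i ∈ R}.indicator (fun _ => c) x := by
  classical
  have : R.filter (fun i => x i ∈ M) = Finset.univ.filter fun i => x i ∈ M ∧ i ∈ R := by
    ext i; simp [and_comm]
  simp_rw [Set.indicator_apply, Set.mem_ofPred_eq]
  rw [cnt, this, ← Finset.sum_filter, Finset.sum_const, nsmul_eq_mul]

variable [MeasurableSpace E]

/-- A sample law whose null and non-null marked sub-distribution functions, at the levels of `t`,
are `π₀ F₀` and `(1 - π₀) F₁`. -/
structure IsMixtureModel (m : ℕ) (ν : Measure E) (η : E → Bool) (p : E → ℝ) (π₀ : ℝ) (F₀ F₁ : ℝ → ℝ)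
    (t : ℕ → ℝ) : Prop where
  prob : IsProbabilityMeasure ν
  measurable_mark : Measurable η
  measurable_pvalue : Measurable p
  pvalue_pos : ∀ e, 0 < p e
  threshold : IsThreshold m t
  null : ∀ k ≤ m, ν.real (levelSet p t k ∩ {e | η e = false}) = π₀ * F₀ (t k)
  alternative : ∀ k ≤ m, ν.real (levelSet p t k ∩ {e | η e = true}) = (1 - π₀) * F₁ (t k)

variable {ν : Measure E} {η : E → Bool} {p : E → ℝ} {π₀ : ℝ} {F₀ F₁ : ℝ → ℝ} {t : ℕ → ℝ}

namespace IsMixtureModel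

lemma measurableSet_mark (h : IsMixtureModel m ν η p π₀ F₀ F₁ t) (b : Bool) :
    MeasurableSet {e | η e = b} := h.measurable_mark (measurableSet_singleton b)

lemma mixture_eq (h : IsMixtureModel m ν η p π₀ F₀ F₁ t) {k : ℕ} (hk : k ≤ m) :
    ν.real (levelSet p t k) = mixture π₀ F₀ F₁ (t k) := by
  have := h.prob
  rw [mixture, ← h.null k hk, ← h.alternative k hk, ← compl_mark_false,
    ← Set.sdiff_eq, measureReal_inter_add_sdiff (h.measurableSet_mark false)]

lemma mixture_mem_Icc (h : IsMixtureModel m ν η p π₀ F₀ F₁ t) {k : ℕ} (hk : k ≤ m) :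
    mixture π₀ F₀ F₁ (t k) ∈ Set.Icc (0 : ℝ) 1 := by
  have := h.prob
  rw [← h.mixture_eq hk]
  exact ⟨measureReal_nonneg, measureReal_le_one⟩

/-- No monotonicity of `F₀` or `F₁` is assumed: at threshold values, the mixture is the mass of
nested level sets. -/
lemma mixture_mono (h : IsMixtureModel m ν η p π₀ F₀ F₁ t) {i j : ℕ} (hij : i ≤ j) (hj : j ≤ m) :
    mixture π₀ F₀ F₁ (t i) ≤ mixture π₀ F₀ F₁ (t j) := by
  have := h.prob
  rw [← h.mixture_eq hj, ← h.mixture_eq (hij.trans hj)]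
  exact measureReal_mono
    (h.threshold.monotoneOn_levelSet p ⟨by omega, hij.trans hj⟩ ⟨by omega, hj⟩ hij)

lemma Psi_upper_eq (h : IsMixtureModel m ν η p π₀ F₀ F₁ t) (k : ℕ) :
    (Psi (m - k) fun j => 1 - ν.real (levelSet p t (m + 1 - j))) =
      Psi (m - k) fun j => 1 - mixture π₀ F₀ F₁ (t (m + 1 - j)) :=
  Psi_congr fun j hj => by rw [h.mixture_eq (by have := hj.1; omega)]

/-- Expectations of functions of the numbers of marked rejections and of rejections. -/
lemma integral_SU_null (h : IsMixtureModel m ν η p π₀ F₀ F₁ t) (f : ℕ → ℕ → ℝ) :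
    ∫ x, f (cnt (SU t fun i => p (x i)) {e | η e = false} x) (SU t fun i => p (x i)).card
        ∂(Measure.pi fun _ : Fin m => ν) =
      ∑ k ∈ Finset.range (m + 1), (m.choose k : ℝ) * ∑ j ∈ Finset.range (k + 1), (k.choose j : ℝ) *
        (f j k * ((π₀ * F₀ (t k)) ^ j * ((1 - π₀) * F₁ (t k)) ^ (k - j) *
          Psi (m - k) fun j => 1 - mixture π₀ F₀ F₁ (t (m + 1 - j)))) := by
  have := h.prob
  rw [integral_SU ν h.threshold h.measurable_pvalue (h.measurableSet_mark false) f]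
  refine Finset.sum_congr rfl fun k hk => ?_
  have hk' := Finset.mem_range_succ_iff.1 hk
  rw [h.Psi_upper_eq, compl_mark_false, h.null k hk', h.alternative k hk']

lemma integral_SU_alternative (h : IsMixtureModel m ν η p π₀ F₀ F₁ t) (f : ℕ → ℕ → ℝ) :
    ∫ x, f (cnt (SU t fun i => p (x i)) {e | η e = true} x) (SU t fun i => p (x i)).card
        ∂(Measure.pi fun _ : Fin m => ν) =
      ∑ k ∈ Finset.range (m + 1), (m.choose k : ℝ) * ∑ j ∈ Finset.range (k + 1), (k.choose j : ℝ) *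
        (f j k * (((1 - π₀) * F₁ (t k)) ^ j * (π₀ * F₀ (t k)) ^ (k - j) *
          Psi (m - k) fun j => 1 - mixture π₀ F₀ F₁ (t (m + 1 - j)))) := by
  have := h.prob
  rw [integral_SU ν h.threshold h.measurable_pvalue (h.measurableSet_mark true) f]
  refine Finset.sum_congr rfl fun k hk => ?_
  have hk' := Finset.mem_range_succ_iff.1 hk
  rw [h.Psi_upper_eq, compl_mark_true, h.null k hk', h.alternative k hk']

/-- Removing `l` rejected hypotheses lowers `m` and `k` together and shifts the levels by `l`, so
the `Psi` factor, which concerns the `m - k` non-rejected ones, does not depend on `l`. -/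
lemma distSU_shift (G : ℕ → ℝ) {l k : ℕ} (hl : l ≤ k) (hk : k ≤ m) :
    distSU (m - l) (fun j => G (j + l)) (k - l) =
      ((m - l).choose (k - l) : ℝ) * G k ^ (k - l) * Psi (m - k) fun j => 1 - G (m + 1 - j) := by
  rw [distSU, Nat.sub_add_cancel hl, show m - l - (k - l) = m - k by omega]
  congr 1
  refine Psi_congr fun j hj => ?_
  have := hj.2
  rw [show m - l + 1 - j + l = m + 1 - j by omega]

/-- The moments of the false discovery proportion of a step-up procedure. -/
theorem integral_FDP_SU_pow (h : IsMixtureModel m ν η p π₀ F₀ F₁ t) {s : ℕ} (hs : 1 ≤ s) :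
    ∫ x, FDP (SU t fun i => p (x i)) (fun i => η (x i)) ^ s ∂(Measure.pi fun _ : Fin m => ν) =
      suFDPmoment m π₀ t s F₀ F₁ := by
  simp_rw [FDP, card_trueNulls_inter]
  rw [h.integral_SU_null fun j k => ((j : ℝ) / (max k 1 : ℕ)) ^ s]
  simp_rw [div_pow, div_eq_mul_inv]
  rw [sum_choose_moment m hs (fun k => π₀ * F₀ (t k)) (fun k => (1 - π₀) * F₁ (t k))
    (fun k => (((max k 1 : ℕ) : ℝ) ^ s)⁻¹)
    (fun k => Psi (m - k) fun j => 1 - mixture π₀ F₀ F₁ (t (m + 1 - j))), suFDPmoment]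
  refine Finset.sum_congr rfl fun l hl => ?_
  rw [Finset.mem_Icc] at hl
  rw [mul_assoc _ (π₀ ^ l), Finset.mul_sum (a := π₀ ^ l)]
  congr 1
  refine Finset.sum_congr rfl fun k hk => ?_
  rw [Finset.mem_Icc] at hk
  -- Since `1 ≤ l ≤ k`, the maximum with `1` in the FDP denominator is inactive.
  rw [distSU_shift (fun j => mixture π₀ F₀ F₁ (t j)) hk.1 hk.2,
    max_eq_left (hl.1.trans hk.1), mul_pow]
  rw [mixture]
  ring

lemma suFDPmoment_one (hm : 1 ≤ m) : suFDPmoment m π₀ t 1 F₀ F₁ = suFDR m π₀ t F₀ F₁ := by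
  rw [suFDPmoment, suFDR]
  have h1 : (m.factorial : ℝ) / ((m - 1).factorial : ℝ) = m := by
    rw [div_eq_iff (by positivity), ← Nat.mul_factorial_pred (by omega : m ≠ 0)]
    push_cast
    ring
  simp only [min_eq_left hm, Finset.Icc_self, Finset.sum_singleton, Nat.stirlingSecond_self,
    pow_one, h1]
  push_cast
  ring

/-- The expected number of rejected false nulls of a step-up procedure. -/
theorem integral_card_falseNulls_SU (h : IsMixtureModel m ν η p π₀ F₀ F₁ t) (hm : 1 ≤ m) :
    ∫ x, ((falseNulls (fun i => η (x i)) ∩ SU t fun i => p (x i)).card : ℝ)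
        ∂(Measure.pi fun _ : Fin m => ν) = (1 - π₀) * m * suPower m π₀ t F₀ F₁ := by
  simp_rw [card_falseNulls_inter]
  rw [h.integral_SU_alternative fun j _ => (j : ℝ)]
  -- First moment with unit weight, the non-null mass now being the counted one.
  have := sum_choose_moment m le_rfl (fun k => (1 - π₀) * F₁ (t k)) (fun k => π₀ * F₀ (t k))
    (fun _ => 1) (fun k => Psi (m - k) fun j => 1 - mixture π₀ F₀ F₁ (t (m + 1 - j)))
  have h1 : (m.factorial : ℝ) / ((m - 1).factorial : ℝ) = m := by
    rw [div_eq_iff (by positivity), ← Nat.mul_factorial_pred (by omega : m ≠ 0)]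
    push_cast
    ring
  simp only [pow_one, mul_one, min_eq_left hm, Finset.Icc_self, Finset.sum_singleton,
    Nat.stirlingSecond_self, Nat.cast_one, h1] at this
  rw [this, suPower, mul_comm (1 - π₀) (m : ℝ), mul_assoc]
  congr 1
  rw [Finset.mul_sum]
  refine Finset.sum_congr rfl fun k hk => ?_
  rw [Finset.mem_Icc] at hk
  rw [distSU_shift (fun j => mixture π₀ F₀ F₁ (t j)) hk.1 hk.2, mixture]
  ring

/-- The distribution function of the false discovery proportion of a step-up procedure. -/
theorem integral_FDP_SU_le (h : IsMixtureModel m ν η p π₀ F₀ F₁ t) {x₀ : ℝ}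
    (hx₀ : x₀ ∈ Set.Ioo (0 : ℝ) 1) :
    ∫ x, (Set.Iic x₀).indicator (fun _ => (1 : ℝ))
        (FDP (SU t fun i => p (x i)) fun i => η (x i)) ∂(Measure.pi fun _ : Fin m => ν) =
      suFDPcdf m π₀ t x₀ F₀ F₁ := by
  have := h.prob
  simp_rw [FDP, card_trueNulls_inter]
  rw [h.integral_SU_null fun j k => (Set.Iic x₀).indicator (fun _ => (1 : ℝ))
    ((j : ℝ) / (max k 1 : ℕ)), suFDPcdf]
  refine Finset.sum_congr rfl fun k hk => ?_
  have hkm := Finset.mem_range_succ_iff.1 hk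
  have hfl : ⌊x₀ * k⌋₊ ≤ k := by
    refine Nat.floor_le_of_le ?_
    have : (0 : ℝ) ≤ k := Nat.cast_nonneg k
    nlinarith [hx₀.2]
  have hsub : Finset.range (⌊x₀ * k⌋₊ + 1) ⊆ Finset.range (k + 1) :=
    Finset.range_subset_range.2 (by omega)
  have hpos : (0 : ℝ) ≤ x₀ * k := mul_nonneg hx₀.1.le (Nat.cast_nonneg k)
  have hiff : ∀ j ≤ k, (j : ℝ) / (max k 1 : ℕ) ≤ x₀ ↔ j ≤ ⌊x₀ * k⌋₊ := by
    intro j hj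
    rw [Nat.le_floor_iff hpos]
    rcases Nat.eq_zero_or_pos k with rfl | hk0
    · have : j = 0 := by omega
      subst this
      simp [hx₀.1.le]
    · rw [max_eq_left hk0, div_le_iff₀ (by exact_mod_cast hk0)]
  rw [Finset.mul_sum]
  rw [← Finset.sum_subset hsub]
  · refine Finset.sum_congr rfl fun j hj => ?_
    have hj' : j ≤ ⌊x₀ * k⌋₊ := Finset.mem_range_succ_iff.1 hj
    have hjk := hj'.trans hfl
    rw [Set.indicator_of_mem (Set.mem_Iic.2 ((hiff j hjk).2 hj')), one_mul, distSU]
    have key : (π₀ * F₀ (t k)) ^ j * ((1 - π₀) * F₁ (t k)) ^ (k - j) =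
        (π₀ * F₀ (t k) / mixture π₀ F₀ F₁ (t k)) ^ j *
          ((1 - π₀) * F₁ (t k) / mixture π₀ F₀ F₁ (t k)) ^ (k - j) *
            mixture π₀ F₀ F₁ (t k) ^ k := by
      -- If the mixture vanishes, so do its two nonnegative parts. Both sides are then `0` for `k >
      -- 0`, and the empty product `1` for `k = 0`.
      rcases eq_or_ne (mixture π₀ F₀ F₁ (t k)) 0 with h0 | h0
      · rcases Nat.eq_zero_or_pos k with rfl | hk0
        · simp [Nat.le_zero.1 hjk]
        · have ha : 0 ≤ π₀ * F₀ (t k) := h.null k hkm ▸ measureReal_nonneg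
          have hb : 0 ≤ (1 - π₀) * F₁ (t k) := h.alternative k hkm ▸ measureReal_nonneg
          have hab : π₀ * F₀ (t k) + (1 - π₀) * F₁ (t k) = 0 := h0
          have ha0 : π₀ * F₀ (t k) = 0 := by linarith
          have hb0 : (1 - π₀) * F₁ (t k) = 0 := by linarith
          rw [ha0, hb0, h0, zero_pow hk0.ne', mul_zero, ← pow_add, Nat.add_sub_cancel' hjk,
            zero_pow hk0.ne']
      · have hpow : mixture π₀ F₀ F₁ (t k) ^ k =
            mixture π₀ F₀ F₁ (t k) ^ j * mixture π₀ F₀ F₁ (t k) ^ (k - j) := by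
          rw [← pow_add, Nat.add_sub_cancel' hjk]
        rw [hpow, div_pow, div_pow]
        field_simp
    rw [key]
    ring
  · intro j hj hj'
    have hjk := Finset.mem_range_succ_iff.1 hj
    rw [Set.indicator_of_notMem]
    · ring
    · rw [Set.mem_Iic, hiff j hjk]
      exact fun hle => hj' (Finset.mem_range_succ_iff.2 hle)

lemma measurableSet_rejected (h : IsMixtureModel m ν η p π₀ F₀ F₁ t) (b : Bool) (i : Fin m) :
    MeasurableSet {x : Fin m → E | x i ∈ {e | η e = b} ∧ i ∈ SD t fun i => p (x i)} := by
  have hp : Measurable fun (x : Fin m → E) i => p (x i) :=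
    measurable_pi_lambda _ fun i => h.measurable_pvalue.comp (measurable_pi_apply i)
  exact (measurable_pi_apply i (h.measurableSet_mark b)).inter (hp (measurableSet_mem_SD t i))

/-- The false discovery rate of a step-down procedure. -/
theorem integral_FDP_SD (h : IsMixtureModel m ν η p π₀ F₀ F₁ t) :
    ∫ x, FDP (SD t fun i => p (x i)) (fun i => η (x i)) ∂(Measure.pi fun _ : Fin m => ν) =
      sdFDR m π₀ t F₀ F₁ := by
  have := h.prob
  let g : ℕ → ℝ := fun k => ((max k 1 : ℕ) : ℝ)⁻¹
  have hpt : ∀ x : Fin m → E, FDP (SD t fun i => p (x i)) (fun i => η (x i)) =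
      ∑ i, {x : Fin m → E | x i ∈ {e | η e = false} ∧ i ∈ SD t fun i => p (x i)}.indicator
        (fun x => g (SD t fun i => p (x i)).card) x := by
    intro x
    rw [FDP, card_trueNulls_inter, div_eq_mul_inv, cnt_eq_sum_indicator]
    rfl
  have hp : Measurable fun (x : Fin m → E) i => p (x i) :=
    measurable_pi_lambda _ fun i => h.measurable_pvalue.comp (measurable_pi_apply i)
  have hcard : Measurable fun x : Fin m → E => g (SD t fun i => p (x i)).card :=
    (measurable_of_countable g).comp ((measurable_card_of_mem (measurableSet_mem_SD t)).comp hp)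
  have hint : Integrable (fun x : Fin m → E => g (SD t fun i => p (x i)).card)
      (Measure.pi fun _ : Fin m => ν) := by
    refine Integrable.of_bound hcard.aestronglyMeasurable 1 (Filter.Eventually.of_forall fun x => ?_)
    rw [Real.norm_of_nonneg (by positivity)]
    exact inv_le_one_of_one_le₀ (by exact_mod_cast le_max_right _ _)
  simp_rw [hpt]
  rw [integral_finsetSum _ fun i _ => hint.indicator (h.measurableSet_rejected false i),
    Finset.sum_congr rfl fun i _ => integral_SD ν h.threshold h.measurable_pvalue h.pvalue_pos
      (h.measurableSet_mark false) i g, Finset.sum_const, Finset.card_univ, Fintype.card_fin,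
    nsmul_eq_mul, sdFDR, mul_comm π₀ (m : ℝ), mul_assoc, sum_Icc_one_eq_sum_range]
  congr 1
  rw [Finset.mul_sum]
  refine Finset.sum_congr rfl fun a ha => ?_
  have ham : a + 1 ≤ m := Finset.mem_range.1 ha
  rw [sum_Icc_eq_sum_range, show m + 1 - (a + 1) = m - a by omega, Finset.mul_sum, Finset.mul_sum]
  refine Finset.sum_congr rfl fun b hb => ?_
  have hbm : a + 1 + b ≤ m := by have := Finset.mem_range.1 hb; omega
  set G : ℕ → ℝ := fun k => mixture π₀ F₀ F₁ (t k) with hG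
  have hGk : ∀ k ≤ m, ν.real (levelSet p t k) = G k := fun k hk => h.mixture_eq hk
  have hPsi₁ : (Psi a fun j => ν.real (levelSet p t j)) = Psi a G :=
    Psi_congr fun j hj => hGk j (by have := hj.2; omega)
  have hPsi₂ : (Psi b fun j => (ν.real (levelSet p t (a + 1 + j)) - ν.real (levelSet p t (a + 1))) /
        (1 - ν.real (levelSet p t (a + 1)))) =
      Psi b fun j => (G (a + 1 + j) - G (a + 1)) / (1 - G (a + 1)) :=
    Psi_congr fun j hj => by rw [hGk _ (by have := hj.2; omega), hGk _ ham]
  -- Reconciles the probability with the two `distSD` factors. With `k = a + 1` and `k' = a + 1 +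
  -- b`, one has `1 - (G (k' + 1) - G k) / (1 - G k) = (1 - G (k' + 1)) / (1 - G k)`, and its powers
  -- cancel against part of `(1 - G k) ^ (m - k)`.
  have hpow : (1 - ν.real (levelSet p t (a + 1 + b + 1))) ^ (m - 1 - a - b) *
        (1 - G (a + 1)) ^ b = (1 - G (a + 1)) ^ (m - (a + 1)) *
      (1 - (G (a + 1 + (b + 1)) - G (a + 1)) / (1 - G (a + 1))) ^ (m - (a + 1) - b) := by
    have he : m - 1 - a - b = m - (a + 1) - b := by omega
    have hs : m - (a + 1) = m - (a + 1) - b + b := by omega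
    rw [he]
    -- Exponent `0` is the case `k' = m`, where the out-of-range level `m + 1` drops out.
    rcases Nat.eq_zero_or_pos (m - (a + 1) - b) with h0 | hpos
    · rw [h0, pow_zero, pow_zero, one_mul, mul_one, hs, h0, zero_add]
    · rw [hGk _ (by omega : a + 1 + b + 1 ≤ m)]
      conv_rhs => rw [hs, pow_add, Nat.add_sub_cancel]
      rw [mul_right_comm, ← mul_pow]
      -- When `G k = 1` the quotient is `0 / 0`, but monotonicity forces `G (k' + 1) = 1` and both
      -- sides contain a zero base with positive exponent.
      rcases eq_or_ne (1 - G (a + 1)) 0 with hz | hz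
      · have h1 : G (a + 1) ≤ G (a + 1 + b + 1) := h.mixture_mono (by omega) (by omega)
        have h2 : G (a + 1 + b + 1) ≤ 1 := (h.mixture_mem_Icc (by omega)).2
        rw [hz, show 1 - G (a + 1 + b + 1) = 0 by linarith, zero_mul]
      · congr 2
        rw [show a + 1 + (b + 1) = a + 1 + b + 1 by omega]
        field_simp
        ring
  rw [hPsi₁, hPsi₂, h.null _ ham, hGk _ ham]
  simp only [distSD, Nat.add_sub_cancel, Nat.add_sub_cancel_left]
  rw [show m - (a + 1) = m - 1 - a by omega] at hpow ⊢
  have hgk : g (a + 1 + b) = ((a + 1 + b : ℕ) : ℝ)⁻¹ := by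
    simp only [g]
    rw [max_eq_left (by omega)]
  rw [hgk]
  linear_combination (((m - 1).choose a : ℝ) * (m - 1 - a).choose b * ((a + 1 + b : ℕ) : ℝ)⁻¹ *
    π₀ * F₀ (t (a + 1)) * Psi a G *
    Psi b fun j => (G (a + 1 + j) - G (a + 1)) / (1 - G (a + 1))) * hpow

/-- The expected number of rejected false nulls of a step-down procedure. -/
theorem integral_card_falseNulls_SD (h : IsMixtureModel m ν η p π₀ F₀ F₁ t) :
    ∫ x, ((falseNulls (fun i => η (x i)) ∩ SD t fun i => p (x i)).card : ℝ)
        ∂(Measure.pi fun _ : Fin m => ν) = (1 - π₀) * m * sdPower m π₀ t F₀ F₁ := by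
  have := h.prob
  have hpt : ∀ x : Fin m → E,
      ((falseNulls (fun i => η (x i)) ∩ SD t fun i => p (x i)).card : ℝ) =
      ∑ i, {x : Fin m → E | x i ∈ {e | η e = true} ∧ i ∈ SD t fun i => p (x i)}.indicator
        (fun _ => (1 : ℝ)) x := by
    intro x
    rw [card_falseNulls_inter, ← mul_one (cnt _ _ _ : ℝ), cnt_eq_sum_indicator]
    rfl
  simp_rw [hpt]
  rw [integral_finsetSum _ fun i _ => (integrable_const _).indicator (h.measurableSet_rejected true i),
    Finset.sum_congr rfl fun i _ => integral_indicator_mem_SD ν h.threshold h.measurable_pvalue h.pvalue_pos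
      (h.measurableSet_mark true) i, Finset.sum_const, Finset.card_univ, Fintype.card_fin,
    nsmul_eq_mul, sdPower, mul_comm (1 - π₀) (m : ℝ), mul_assoc, sum_Icc_one_eq_sum_range]
  congr 1
  rw [Finset.mul_sum]
  refine Finset.sum_congr rfl fun a ha => ?_
  have ham : a + 1 ≤ m := Finset.mem_range.1 ha
  have hPsi : (Psi a fun j => ν.real (levelSet p t j)) = Psi a fun j => mixture π₀ F₀ F₁ (t j) :=
    Psi_congr fun j hj => h.mixture_eq (by have := hj.2; omega)
  rw [hPsi, h.alternative _ ham, h.mixture_eq ham]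
  simp only [distSD, Nat.add_sub_cancel]
  ring

end IsMixtureModel

end IndependentFormulas

/-! ### Mixing over the common factor -/

/-- For fixed `u` in the open interval the quantile is finite, and the conditional c.d.f.
computations supply the two sub-distribution functions. -/
lemma isMixtureModel_markedNoise {m : ℕ} {π₀ ρ u : ℝ} (μ : ℝ) (hπ₀ : π₀ ∈ Set.Icc (0 : ℝ) 1)
    (hρ : ρ ∈ Set.Icc (0 : ℝ) 1) (hu : u ∈ Set.Ioo (0 : ℝ) 1) {t : ℕ → ℝ} (ht : IsThreshold m t) :
    IsMixtureModel m (markedNoise π₀) Prod.fst (pvalue ρ μ u) π₀ (condF0 ρ u) (condF1 ρ μ u) t := by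
  have hπ := isProbabilityMeasure_indicatorLaw hπ₀
  have hν : IsProbabilityMeasure (markedNoise π₀) := by unfold markedNoise; infer_instance
  have hp : Measurable (pvalue ρ μ u) :=
    (measurable_pvalue ρ μ).comp (f := fun e : Bool × ℝ => (u, e)) measurable_prodMk_left
  have hset : ∀ k b, levelSet (pvalue ρ μ u) t k ∩ {e | e.1 = b} =
      {e | e.1 = b ∧ pvalue ρ μ u e ≤ t k} := fun k b => Set.inter_comm _ _
  refine ⟨hν, measurable_fst, hp, pvalue_pos ρ μ u, ht, fun k hk => ?_, fun k hk => ?_⟩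
  · rw [hset, markedNoise_pvalue_false μ hπ₀ hρ hu (ht.mem_Icc' hk)]
  · rw [hset, markedNoise_pvalue_true μ hπ₀ hρ hu (ht.mem_Icc' hk)]

/-- Fubini's theorem for the common factor representation: an expectation under the equicorrelated
model is the integral over the common factor of the expectations under independent models. -/
lemma integral_uncondEMN {m : ℕ} {π₀ ρ : ℝ} (μ : ℝ) (hπ₀ : π₀ ∈ Set.Icc (0 : ℝ) 1)
    (hρ : ρ ∈ Set.Icc (0 : ℝ) 1) {f : (Fin m → Bool) × (Fin m → ℝ) → ℝ} (hf : Measurable f) {C : ℝ}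
    (hC : ∀ z, f z ∈ Set.Icc 0 C) {g : ℝ → ℝ}
    (hg : ∀ u ∈ Set.Ioo (0 : ℝ) 1, ∫ x, f (fun i => (x i).1, fun i => pvalue ρ μ u (x i))
      ∂(Measure.pi fun _ : Fin m => markedNoise π₀) = g u) :
    IntegrableOn g (Set.Ioo 0 1) ∧
      ∫ z, f z ∂(uncondEMN m π₀ ρ μ) = ∫ u in Set.Ioo (0 : ℝ) 1, g u := by
  have hπ := isProbabilityMeasure_indicatorLaw hπ₀
  have hν : IsProbabilityMeasure (markedNoise π₀) := by unfold markedNoise; infer_instance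
  have hT : Measurable fun z : ℝ × (Fin m → Bool × ℝ) =>
      ((fun i => (z.2 i).1, fun i => pvalue ρ μ z.1 (z.2 i)) : (Fin m → Bool) × (Fin m → ℝ)) := by
    refine Measurable.prodMk (by fun_prop) (measurable_pi_lambda _ fun i => ?_)
    exact (measurable_pvalue ρ μ).comp (f := fun z : ℝ × (Fin m → Bool × ℝ) => (z.1, z.2 i))
      (by fun_prop)
  have hint : Integrable (fun z : ℝ × (Fin m → Bool × ℝ) =>
        f (fun i => (z.2 i).1, fun i => pvalue ρ μ z.1 (z.2 i)))
      (((volume : Measure ℝ).restrict (Set.Ioo 0 1)).prod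
        (Measure.pi fun _ : Fin m => markedNoise π₀)) := by
    refine Integrable.of_bound (hf.comp hT).aestronglyMeasurable C
      (Filter.Eventually.of_forall fun z => ?_)
    rw [Real.norm_of_nonneg (hC _).1]
    exact (hC _).2
  have hae : (fun u => ∫ x, f (fun i => (x i).1, fun i => pvalue ρ μ u (x i))
      ∂(Measure.pi fun _ : Fin m => markedNoise π₀)) =ᵐ[(volume : Measure ℝ).restrict (Set.Ioo 0 1)]
        g := by
    filter_upwards [ae_restrict_mem measurableSet_Ioo] with u hu using hg u hu
  -- The closed form `g` equals the inner integral almost everywhere on `(0,1)`, so it inherits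
  -- integrability without a direct study of its measurability.
  refine ⟨hint.integral_prod_left.congr hae, ?_⟩
  rw [uncondEMN_eq_map m μ hπ₀ hρ, integral_map hT.aemeasurable hf.aestronglyMeasurable,
    integral_prod _ hint]
  exact integral_congr_ae hae

lemma card_falseNulls_inter_le {m : ℕ} (R : Finset (Fin m)) (H : Fin m → Bool) :
    (falseNulls H ∩ R).card ≤ m := by
  simpa using Finset.card_le_univ (falseNulls H ∩ R)

end

end StepwiseFDP

/-! ### Integrating the six i.i.d. formulas over the common factor -/

open StepwiseFDP
theorem corollary3p3 (m : ℕ) (hm : 2 ≤ m) (π₀ ρ μ : ℝ) (hπ₀ : π₀ ∈ Set.Icc (0 : ℝ) 1)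
    (hρ : ρ ∈ Set.Icc (0 : ℝ) 1) (hμ : 0 < μ) (t : ℕ → ℝ) (ht : IsThreshold m t) :
    -- step-up: c.d.f. of the FDP
    (∀ x ∈ Set.Ioo (0 : ℝ) 1,
      MeasureTheory.IntegrableOn
        (fun u => suFDPcdf m π₀ t x (condF0 ρ u) (condF1 ρ μ u)) (Set.Ioo 0 1) ∧
      (uncondEMN m π₀ ρ μ).real {z | FDP (SU t z.2) z.1 ≤ x} =
        ∫ u in Set.Ioo (0 : ℝ) 1, suFDPcdf m π₀ t x (condF0 ρ u) (condF1 ρ μ u)) ∧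
    -- step-up: moments of the FDP
    (∀ s : ℕ, 1 ≤ s →
      MeasureTheory.IntegrableOn
        (fun u => suFDPmoment m π₀ t s (condF0 ρ u) (condF1 ρ μ u)) (Set.Ioo 0 1) ∧
      ∫ z, FDP (SU t z.2) z.1 ^ s ∂(uncondEMN m π₀ ρ μ) =
        ∫ u in Set.Ioo (0 : ℝ) 1, suFDPmoment m π₀ t s (condF0 ρ u) (condF1 ρ μ u)) ∧
    -- step-up: FDR
    (MeasureTheory.IntegrableOn
        (fun u => suFDR m π₀ t (condF0 ρ u) (condF1 ρ μ u)) (Set.Ioo 0 1) ∧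
      FDR (SU t) (uncondEMN m π₀ ρ μ) =
        ∫ u in Set.Ioo (0 : ℝ) 1, suFDR m π₀ t (condF0 ρ u) (condF1 ρ μ u)) ∧
    -- step-up: power
    (π₀ < 1 →
      MeasureTheory.IntegrableOn
        (fun u => suPower m π₀ t (condF0 ρ u) (condF1 ρ μ u)) (Set.Ioo 0 1) ∧
      power (SU t) (1 - π₀) (uncondEMN m π₀ ρ μ) =
        ∫ u in Set.Ioo (0 : ℝ) 1, suPower m π₀ t (condF0 ρ u) (condF1 ρ μ u)) ∧
    -- step-down: FDR
    (MeasureTheory.IntegrableOn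
        (fun u => sdFDR m π₀ t (condF0 ρ u) (condF1 ρ μ u)) (Set.Ioo 0 1) ∧
      FDR (SD t) (uncondEMN m π₀ ρ μ) =
        ∫ u in Set.Ioo (0 : ℝ) 1, sdFDR m π₀ t (condF0 ρ u) (condF1 ρ μ u)) ∧
    -- step-down: power
    (π₀ < 1 →
      MeasureTheory.IntegrableOn
        (fun u => sdPower m π₀ t (condF0 ρ u) (condF1 ρ μ u)) (Set.Ioo 0 1) ∧
      power (SD t) (1 - π₀) (uncondEMN m π₀ ρ μ) =
        ∫ u in Set.Ioo (0 : ℝ) 1, sdPower m π₀ t (condF0 ρ u) (condF1 ρ μ u)) := by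
  have hm1 : 1 ≤ m := by omega
  have hmodel := fun u (hu : u ∈ Set.Ioo (0 : ℝ) 1) => isMixtureModel_markedNoise μ hπ₀ hρ hu ht
  have hSU := measurableSet_mem_SU (m := m) t
  have hSD := measurableSet_mem_SD (m := m) t
  -- Moving `((1 - π₀) * m)⁻¹` inside the expectation cancels the prefactor of the i.i.d. formula;
  -- `π₀ < 1` makes it invertible.
  have hpower : ∀ {R : (Fin m → ℝ) → Finset (Fin m)} {g : ℝ → ℝ},
      (∀ i, MeasurableSet {p | i ∈ R p}) → π₀ < 1 →
      (∀ u ∈ Set.Ioo (0 : ℝ) 1,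
        ∫ x, ((falseNulls (fun i => (x i).1) ∩ R fun i => pvalue ρ μ u (x i)).card : ℝ)
          ∂(MeasureTheory.Measure.pi fun _ : Fin m => markedNoise π₀) = (1 - π₀) * m * g u) →
      MeasureTheory.IntegrableOn g (Set.Ioo 0 1) ∧
        power R (1 - π₀) (uncondEMN m π₀ ρ μ) = ∫ u in Set.Ioo (0 : ℝ) 1, g u := by
    intro R g hR hlt hg
    have hc : 0 < (1 - π₀) * (m : ℝ) :=
      mul_pos (sub_pos.2 hlt) (by exact_mod_cast hm1)
    rw [power, ← MeasureTheory.integral_const_mul]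
    refine integral_uncondEMN μ hπ₀ hρ (C := ((1 - π₀) * m)⁻¹ * m)
      ((measurable_card_falseNulls_inter hR).const_mul _) (fun z => ⟨by positivity, ?_⟩)
      fun u hu => ?_
    · exact mul_le_mul_of_nonneg_left (by exact_mod_cast card_falseNulls_inter_le _ _)
        (inv_nonneg.2 hc.le)
    · simp only
      rw [MeasureTheory.integral_const_mul, hg u hu, inv_mul_cancel_left₀ hc.ne']
  refine ⟨fun x hx => ?_, fun s hs => ?_, ?_, fun h => ?_, ?_, fun h => ?_⟩
  · have hset : MeasurableSet {z : (Fin m → Bool) × (Fin m → ℝ) | FDP (SU t z.2) z.1 ≤ x} :=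
      measurableSet_le (measurable_FDP hSU) measurable_const
    have := integral_uncondEMN μ hπ₀ hρ (C := 1)
      (f := {z : (Fin m → Bool) × (Fin m → ℝ) | FDP (SU t z.2) z.1 ≤ x}.indicator
        fun _ => (1 : ℝ)) (measurable_const.indicator hset)
      (fun z => ⟨Set.indicator_nonneg (fun _ _ => zero_le_one) z,
        Set.indicator_le_self' (fun _ _ => zero_le_one) z⟩)
      fun u hu => (hmodel u hu).integral_FDP_SU_le hx
    rwa [MeasureTheory.integral_indicator_const _ hset, smul_eq_mul, mul_one] at this
  · exact integral_uncondEMN μ hπ₀ hρ (C := 1) ((measurable_FDP hSU).pow_const s)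
      (fun z => ⟨pow_nonneg (FDP_mem_Icc _ _).1 s,
        pow_le_one₀ (FDP_mem_Icc _ _).1 (FDP_mem_Icc _ _).2⟩)
      fun u hu => (hmodel u hu).integral_FDP_SU_pow hs
  · refine integral_uncondEMN μ hπ₀ hρ (measurable_FDP hSU) (fun z => FDP_mem_Icc _ _)
      fun u hu => ?_
    -- The FDR is the moment of order `1`, for which only `l = 1` survives.
    rw [← IsMixtureModel.suFDPmoment_one hm1, ← (hmodel u hu).integral_FDP_SU_pow le_rfl]
    simp_rw [pow_one]
  · exact hpower hSU h fun u hu => (hmodel u hu).integral_card_falseNulls_SU hm1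
  · exact integral_uncondEMN μ hπ₀ hρ (measurable_FDP hSD) (fun z => FDP_mem_Icc _ _)
      fun u hu => (hmodel u hu).integral_FDP_SD
  · exact hpower hSD h fun u hu => (hmodel u hu).integral_card_falseNulls_SD
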